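/- **Setting.** Let $D\ge 1$, let $\mathcal A$ be a finite alphabet, let $\mathfrak A\subseteq\mathcal A^{\mathbb Z^D}$ be a subshift of finite type, and let $\Phi:\mathcal A^{\mathbb Z^D}\to\mathcal A^{\mathbb Z^D}$ be a cellular automaton (a continuous map commuting with all shifts) with $\Phi(\mathfrak A)\subseteq\mathfrak A$. Let $q$ be a radius of $\Phi$. Put $\mathbb B(r)=\{-r,\dots,r\}^D$, and let $\mathfrak A_{(r)}$ be the set of $\mathbb B(r)$-blocks occurring in elements of $\mathfrak A$. **Defects.** For a configuration $\mathbf a$ and $r\ge0$ let $\mathbb G_r(\mathbf a)$ be the set of $z\in\mathbb Z^D$ with $\mathbf a_{z+\mathbb B(r)}\in\mathfrak A_{(r)}$. Let $\widetilde{\mathfrak A}$ be the set of all $\mathbf a$ with $\mathbb G_r(\mathbf a)\ne\emptyset$ for all $r$. Call $\mathbf a$ *defective* if $\mathbf a\in\widetilde{\mathfrak A}\setminus\mathfrak A$. The defect of $\mathbf a$ is *$\Phi$-persistent* if $\Phi^t(\mathbf a)$ is defective for all $t\ge0$. Let $\mathbf G_r(\mathbf a)\subseteq\mathbb R^D$ be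 the union of the unit cubes $z+[0,1]^D$ ($z\in\mathbb Z^D$) all of whose corners lie in $\mathbb G_r(\mathbf a)$; so $\mathbf G_s(\mathbf a)\subseteq\mathbf G_r(\mathbf a)$ for $r\le s$. **Tile complexes.** Let $\mathbf X_r$ be the cell complex obtained from the labelled unit cubes $(z+[0,1]^D)\times\{b\}$ ($z\in\mathbb Z^D$, $b\in\mathfrak A_{(r)}$) by gluing the cube $(z,b)$ to the cube $(z+e_d,b')$ along their common facet whenever $b(x+e_d)=b'(x)$ for all $x$ with $x,\,x+e_d\in\mathbb B(r)$. Restriction of blocks gives cellular maps $\mathbf X_s\to\mathbf X_r$ ($r\le s$), $\Phi$ gives cellular maps $\Phi_*:\mathbf X_{r+q}\to\mathbf X_r$, and $\mathbf a$ gives a continuous cellular map $\varsigma^r_{\mathbf a}:\mathbf G_r(\mathbf a)\to\mathbf X_r$ sending a point $p$ of a cube $z+[0,1]^D$ of $\mathbf G_r(\mathbf a)$ to the point $p$ of the cube $(z,\mathbf a_{z+\mathbb B(r)})$. These are compatible with restriction. For $\mathbf c\in\mathfrak A$ let $x_r(\mathbf c)\in\mathbf X_r$ be the corner over $0$ of the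 cube $(0,\mathbf c_{\mathbb B(r)})$. **Groups.** For an abelian group $\mathcal G$, using cellular (cubical) (co)homology, put $$\pi_k(\mathfrak A,\mathbf c)=\varprojlim_r\pi_k(\mathbf X_r,x_r(\mathbf c)),\quad \mathcal H_k(\mathfrak A,\mathcal G)=\varprojlim_r \mathcal H_k(\mathbf X_r,\mathcal G),\quad \mathcal H^k(\mathfrak A,\mathcal G)=\varinjlim_r \mathcal H^k(\mathbf X_r,\mathcal G),$$ $$\mathcal H_k[\mathbb G_\infty(\mathbf a),\mathcal G]=\varprojlim_r \mathcal H_k(\mathbf G_r(\mathbf a),\mathcal G),\qquad \mathcal H^k[\mathbb G_\infty(\mathbf a),\mathcal G]=\varinjlim_r \mathcal H^k(\mathbf G_r(\mathbf a),\mathcal G).$$ The maps $\Phi_*$ induce $\pi_k\Phi:\pi_k(\mathfrak A,\mathbf c)\to\pi_k(\mathfrak A,\Phi(\mathbf c))$ and endomorphisms $\mathcal H_k\Phi$ of $\mathcal H_k(\mathfrak A,\mathcal G)$ and $\mathcal H^k\Phi$ of $\mathcal H^k(\mathfrak A,\mathcal G)$. The maps $\varsigma^r_{\mathbf a}$ induce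 the signatures $\mathcal H_k\mathbf a:\mathcal H_k[\mathbb G_\infty(\mathbf a),\mathcal G]\to\mathcal H_k(\mathfrak A,\mathcal G)$ and $\mathcal H^k\mathbf a:\mathcal H^k(\mathfrak A,\mathcal G)\to\mathcal H^k[\mathbb G_\infty(\mathbf a),\mathcal G]$. A *proper base ray* for $\mathbf a$ is a continuous $\omega:[0,\infty)\to\mathbb R^D$ with $|\omega(t)|\to\infty$ such that for every $r$, $\omega(t)\in\mathbf G_r(\mathbf a)$ for all large $t$. It yields $\pi_k[\mathbb G_\infty(\mathbf a),\omega]=\varprojlim_r\pi_k(\mathbf G_r(\mathbf a),\omega)$, where $\pi_k(\,\cdot\,,\omega)$ means $\pi_k$ based at $\omega(t)$ for any large $t$, different $t$ being identified by transport along $\omega$; the maps $\varsigma^r_{\mathbf a}$ then induce the homotopy signature $\pi_k\mathbf a$ from $\pi_k[\mathbb G_\infty(\mathbf a),\omega]$ to $\varprojlim_r\pi_k(\mathbf X_r,\varsigma^r_{\mathbf a}\circ\omega)$. An element $\mathbf a\in\widetilde{\mathfrak A}$ has a *homotopy* (resp. *homology*, *cohomology*) *defect of codimension $k+1$* if $\pi_k\mathbf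 a$ for some proper base ray (resp. $\mathcal H_k\mathbf a$, $\mathcal H^k\mathbf a$) is nontrivial. **Basepoint-freeness.** $\mathfrak A$ is *basepoint-free in codimension $k+1$* if one of the following holds: (i) for all large $r$ the projection from the vertices of $\mathbf X_r$ to $\mathbb Z^D$ is injective; (ii) $\mathfrak A$ is topologically weakly mixing, $k=1$, and for some $\mathbf c\in\mathfrak A$ the tower $\pi_1(\mathbf X_r,x_r(\mathbf c))$ is abelian, in the sense that for every $r$ there is $s\ge r$ such that the image of $\pi_1(\mathbf X_s,x_s(\mathbf c))$ in $\pi_1(\mathbf X_r,x_r(\mathbf c))$ is abelian; (iii) $\mathfrak A$ is topologically weakly mixing and for some $\mathbf c\in\mathfrak A$ the tower $\pi_1(\mathbf X_r,x_r(\mathbf c))$ is trivial, in the same sense. **Corollary.** Let $k\ge1$. (a) Suppose $\mathfrak A$ is basepoint-free in codimension $k+1$. If $\pi_k\Phi:\pi_k(\mathfrak A,\mathbf c)\to\pi_k(\mathfrak A,\Phi(\mathbf c))$ is injective for some $\mathbf c\in\mathfrak A$, then every homotopy defect of codimension $k+1$ is $\Phi$-persistent. (b) For every abelian group $\mathcal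 G$: if $\mathcal H_k\Phi:\mathcal H_k(\mathfrak A,\mathcal G)\to\mathcal H_k(\mathfrak A,\mathcal G)$ is injective, then every homology defect (with coefficients in $\mathcal G$) of codimension $k+1$ is $\Phi$-persistent. (c) For every abelian group $\mathcal G$: if $\mathcal H^k\Phi:\mathcal H^k(\mathfrak A,\mathcal G)\to\mathcal H^k(\mathfrak A,\mathcal G)$ is surjective, then every cohomology defect (with coefficients in $\mathcal G$) of codimension $k+1$ is $\Phi$-persistent. -/

import Mathlib

open Set Filter Topology
open scoped NNReal unitInterval

namespace CADefect

universe u v v' w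

/-! ### Configurations, subshifts, cellular automata -/

section Symbolic

variable {D : ℕ} {A : Type u}

/-- The lattice `ℤ^D`. -/
abbrev Lattice (D : ℕ) := Fin D → ℤ

/-- Configurations `A^(ℤ^D)`; they carry the product topology when `A` is discrete. -/
abbrev Config (D : ℕ) (A : Type u) := Lattice D → A

/-- The `d`-th unit vector. -/
abbrev unitVec (d : Fin D) : Lattice D := Pi.single d 1

/-- The shift by `v`. -/
def shift (v : Lattice D) (a : Config D A) : Config D A := fun z => a (z + v)

/-- A subshift: closed and invariant under all shifts. -/
def IsSubshift [TopologicalSpace A] (S : Set (Config D A)) : Prop :=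
  IsClosed S ∧ ∀ v : Lattice D, shift v '' S = S

/-- The cube `B(r) = [-r..r]^D`. -/
def box (D r : ℕ) : Set (Lattice D) := {x | ∀ i, |x i| ≤ (r : ℤ)}

/-- Words of shape `B(r)`. -/
abbrev Block (D : ℕ) (A : Type u) (r : ℕ) := box D r → A

/-- The word of `a` on `B(z, r) = z + B(r)`, read as a word of shape `B(r)`. -/
def blockAt (a : Config D A) (r : ℕ) (z : Lattice D) : Block D A r := fun x => a (z + x.1)

/-- The admissible `r`-blocks of `S`. -/
def Adm (S : Set (Config D A)) (r : ℕ) : Set (Block D A r) := (fun a => blockAt a r 0) '' S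

/-- A subshift of finite type. -/
def IsSFT [TopologicalSpace A] (S : Set (Config D A)) : Prop :=
  IsSubshift S ∧ ∃ R : ℕ, 0 < R ∧ S = {a | ∀ z, blockAt a R z ∈ Adm S R}

/-- Topological weak mixing: the shift action on `S × S` is topologically transitive. -/
def IsWeaklyMixing [TopologicalSpace A] (S : Set (Config D A)) : Prop :=
  ∀ U V : Set (Config D A × Config D A), IsOpen U → IsOpen V →
    (U ∩ S ×ˢ S).Nonempty → (V ∩ S ×ˢ S).Nonempty →
      ∃ z : Lattice D, (Prod.map (shift z) (shift z) '' (U ∩ S ×ˢ S) ∩ (V ∩ S ×ˢ S)).Nonempty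

/-- A cellular automaton: a continuous self-map of `A^(ℤ^D)` commuting with all shifts. -/
def IsCA [TopologicalSpace A] (Φ : Config D A → Config D A) : Prop :=
  Continuous Φ ∧ ∀ v a, Φ (shift v a) = shift v (Φ a)

/-- `Φ` is given by a local rule of radius `q`. -/
def HasRadius (Φ : Config D A → Config D A) (q : ℕ) : Prop :=
  ∀ (a b : Config D A) (z w : Lattice D),
    (∀ x ∈ box D q, a (z + x) = b (w + x)) → Φ a z = Φ b w

theorem IsCA.exists_radius [Finite A] [TopologicalSpace A] [DiscreteTopology A]
    {Φ : Config D A → Config D A} (hΦ : IsCA Φ) : ∃ q, HasRadius Φ q := by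
  classical
  have hc : Continuous fun a : Config D A => Φ a 0 := (continuous_apply 0).comp hΦ.1
  have h1 : ∀ a : Config D A, ∃ K : Finset (Lattice D),
      ∀ b : Config D A, (∀ i ∈ K, b i = a i) → Φ b 0 = Φ a 0 := by
    intro a
    have ho : IsOpen {b : Config D A | Φ b 0 = Φ a 0} :=
      (isOpen_discrete {Φ a 0}).preimage hc
    obtain ⟨K, t, ht, hsub⟩ := isOpen_pi_iff.1 ho a rfl
    exact ⟨K, fun b hb => hsub fun i hi => by rw [hb i hi]; exact (ht i hi).2⟩
  choose K hK using h1
  have hopen : ∀ a : Config D A, IsOpen {b : Config D A | ∀ i ∈ K a, b i = a i} := by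
    intro a
    have : {b : Config D A | ∀ i ∈ K a, b i = a i}
        = ⋂ i ∈ K a, {b : Config D A | b i = a i} := by
      ext b; simp
    rw [this]
    refine isOpen_biInter_finset fun i _ => ?_
    have hci : Continuous fun b : Config D A => b i := continuous_apply i
    exact (isOpen_discrete {a i}).preimage hci
  obtain ⟨T, hT⟩ := isCompact_univ.elim_finite_subcover
    (fun a : Config D A => {b : Config D A | ∀ i ∈ K a, b i = a i}) hopen
    (fun b _ => mem_iUnion.2 ⟨b, fun _ _ => rfl⟩)
  let q : ℕ := (T.biUnion K).sup fun x => Finset.univ.sup fun j => (x j).natAbs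
  have hq : ∀ x ∈ T.biUnion K, x ∈ box D q := by
    intro x hx i
    have h2 : (x i).natAbs ≤ Finset.univ.sup fun j => (x j).natAbs :=
      Finset.le_sup (f := fun j => (x j).natAbs) (Finset.mem_univ i)
    have h3 : (Finset.univ.sup fun j => (x j).natAbs) ≤ q :=
      Finset.le_sup (f := fun x : Lattice D => Finset.univ.sup fun j => (x j).natAbs) hx
    rw [Int.abs_eq_natAbs]
    exact_mod_cast h2.trans h3
  have key : ∀ a b : Config D A, (∀ x ∈ box D q, a x = b x) → Φ a 0 = Φ b 0 := by
    intro a b hab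
    obtain ⟨c, hcT, hc'⟩ := mem_iUnion₂.1 (hT (mem_univ a))
    have ha := hK c a hc'
    have hb := hK c b fun i hi => by
      rw [← hab i (hq i (Finset.mem_biUnion.2 ⟨c, hcT, hi⟩))]; exact hc' i hi
    rw [ha, hb]
  refine ⟨q, fun a b z w h => ?_⟩
  have h0 : ∀ (a : Config D A) z, Φ a z = Φ (shift z a) 0 := by
    intro a z; rw [hΦ.2]; simp [shift]
  rw [h0 a z, h0 b w]
  refine key _ _ fun x hx => ?_
  have := h x hx
  simpa [shift, add_comm] using this

/-- A radius of the cellular automaton `Φ`. -/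
noncomputable def IsCA.radius [Finite A] [TopologicalSpace A] [DiscreteTopology A]
    {Φ : Config D A → Config D A} (hΦ : IsCA Φ) : ℕ := hΦ.exists_radius.choose

theorem IsCA.hasRadius [Finite A] [TopologicalSpace A] [DiscreteTopology A]
    {Φ : Config D A → Config D A} (hΦ : IsCA Φ) : HasRadius Φ hΦ.radius :=
  hΦ.exists_radius.choose_spec

/-! ### Defects -/

theorem box_mono {r s : ℕ} (h : r ≤ s) : box D r ⊆ box D s :=
  fun _ hx i => (hx i).trans (by exact_mod_cast h)

/-- Restriction of a word from `B(s)` to `B(r)`. -/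
def Block.restrict {r s : ℕ} (h : r ≤ s) (b : Block D A s) : Block D A r :=
  fun x => b ⟨x.1, box_mono h x.2⟩

theorem Adm.restrict {S : Set (Config D A)} {r s : ℕ} (h : r ≤ s) {b : Block D A s}
    (hb : b ∈ Adm S s) : Block.restrict h b ∈ Adm S r := by
  obtain ⟨a, ha, rfl⟩ := hb
  exact ⟨a, ha, rfl⟩

/-- The defect field of `a` relative to `S`. -/
noncomputable def defectField (S : Set (Config D A)) (a : Config D A) (z : Lattice D) : ℕ∞ :=
  ⨆ r ∈ {r : ℕ | blockAt a r z ∈ Adm S r}, (r : ℕ∞)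

/-- The set `G_r(a)` of sites around which the `r`-block of `a` is admissible. -/
def unflawed (S : Set (Config D A)) (a : Config D A) (r : ℕ) : Set (Lattice D) :=
  {z | blockAt a r z ∈ Adm S r}

theorem unflawed_anti (S : Set (Config D A)) (a : Config D A) {r s : ℕ} (h : r ≤ s) :
    unflawed S a s ⊆ unflawed S a r :=
  fun _ hz => Adm.restrict h hz

/-- For `r > 0`, `G_r(a)` is the set of sites where the defect field is at least `r`. -/
theorem le_defectField_iff (S : Set (Config D A)) (a : Config D A) (z : Lattice D) {r : ℕ}
    (hr : 0 < r) : (r : ℕ∞) ≤ defectField S a z ↔ z ∈ unflawed S a r := by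
  constructor
  · intro h
    by_contra hz
    have hle : defectField S a z ≤ ((r - 1 : ℕ) : ℕ∞) := by
      refine iSup₂_le fun s hs => ?_
      have : s < r := by
        by_contra hsr
        exact hz (unflawed_anti S a (not_lt.1 hsr) hs)
      exact_mod_cast Nat.le_sub_one_of_lt this
    have h2 : r ≤ r - 1 := by exact_mod_cast h.trans hle
    omega
  · intro h
    exact le_iSup₂ (f := fun (s : ℕ) (_ : s ∈ {s : ℕ | blockAt a s z ∈ Adm S s}) => (s : ℕ∞)) r h

/-- The `slightly defective' configurations: the defect field is unbounded. -/
def slightlyDefective (S : Set (Config D A)) : Set (Config D A) :=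
  {a | ⨆ z, defectField S a z = ⊤}

/-- `a` is defective. -/
def IsDefective (S : Set (Config D A)) (a : Config D A) : Prop :=
  a ∈ slightlyDefective S ∧ a ∉ S

/-- The defect of `a` is `Φ`-persistent: all iterates `Φ^t(a)` are defective. -/
def IsPersistent (S : Set (Config D A)) (Φ : Config D A → Config D A) (a : Config D A) : Prop :=
  ∀ t : ℕ, IsDefective S (Φ^[t] a)

end Symbolic

/-! ### Unit cubes and the faces of the canonical cell complex of `ℝ^D` -/

section Geometry

variable {D : ℕ}

/-- The unit cube `z + [0,1]^D`. -/
def unitCube (z : Lattice D) : Set (Fin D → ℝ) := {p | ∀ i, (z i : ℝ) ≤ p i ∧ p i ≤ z i + 1}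

/-- The base points of those unit cubes all of whose corners lie in `Y`. -/
def cubesIn (Y : Set (Lattice D)) : Set (Lattice D) := {z | Icc z (z + 1) ⊆ Y}

/-- The union of the unit cubes all of whose corners lie in `Y`. -/
def thicken (Y : Set (Lattice D)) : Set (Fin D → ℝ) := {p | ∃ z ∈ cubesIn Y, p ∈ unitCube z}

theorem cubesIn_mono {Y Y' : Set (Lattice D)} (h : Y ⊆ Y') : cubesIn Y ⊆ cubesIn Y' :=
  fun _ hz => Subset.trans hz h

theorem cubesIn_subset (Y : Set (Lattice D)) : cubesIn Y ⊆ Y :=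
  fun z hz => hz ⟨le_refl z, fun i => by simp⟩

theorem thicken_mono {Y Y' : Set (Lattice D)} (h : Y ⊆ Y') : thicken Y ⊆ thicken Y' :=
  fun _ ⟨z, hz, hp⟩ => ⟨z, cubesIn_mono h hz, hp⟩

/-- A face of the canonical cell complex of `ℝ^D`: the product of the intervals
`[base i, base i + 1]` for `i ∈ dirs` and of the points `base i` for `i ∉ dirs`. -/
@[ext] structure Face (D : ℕ) where
  base : Lattice D
  dirs : Finset (Fin D)

/-- The facet of `F` with minimal `i`-th coordinate (`F` itself if `i ∉ dirs`). -/
def Face.lower (i : Fin D) (F : Face D) : Face D := ⟨F.base, F.dirs.erase i⟩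

/-- The facet of `F` with maximal `i`-th coordinate (`F` itself if `i ∉ dirs`). -/
def Face.upper (i : Fin D) (F : Face D) : Face D :=
  ⟨if i ∈ F.dirs then F.base + unitVec i else F.base, F.dirs.erase i⟩

/-- `F` is a face of the unit cube at `z`. -/
def Face.InCube (F : Face D) (z : Lattice D) : Prop :=
  ∀ i, F.base i = z i ∨ (i ∉ F.dirs ∧ F.base i = z i + 1)

theorem Face.InCube.lower {F : Face D} {z : Lattice D} (h : F.InCube z) (i : Fin D) :
    (F.lower i).InCube z := by
  intro j
  rcases h j with h | ⟨h, h'⟩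
  · exact Or.inl h
  · exact Or.inr ⟨fun hj => h (Finset.mem_of_mem_erase hj), h'⟩

theorem Face.InCube.upper {F : Face D} {z : Lattice D} (h : F.InCube z) (i : Fin D) :
    (F.upper i).InCube z := by
  intro j
  by_cases hi : i ∈ F.dirs
  · by_cases hj : j = i
    · subst hj
      rcases h j with h | ⟨h, -⟩
      · right; simp [Face.upper, hi, h]
      · exact absurd hi h
    · rcases h j with h | ⟨h, h'⟩
      · left; simp [Face.upper, hi, h, hj]
      · right; simp [Face.upper, hi, h, h', hj]
  · rcases h j with h | ⟨h, h'⟩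
    · left; simp [Face.upper, hi, h]
    · right; simp [Face.upper, hi, h, h']

/-- Two unit cubes of `thicken Y` which meet are joined by a chain of facewise adjacent unit cubes
with base points in `Y` containing their intersection. -/
theorem chain_eq {Y : Set (Lattice D)} {J : Fin D → ℤ → Prop}
    (hJ : ∀ i m n, J i m → J i n → n ≤ m + 1) {α : Sort*}
    (f : ∀ w : Lattice D, w ∈ Y → (∀ i, J i (w i)) → α)
    (hf : ∀ w d h1 h2 h3 h4, f w h1 h2 = f (w + unitVec d) h3 h4)
    {z z' : Lattice D} (hz : z ∈ cubesIn Y) (hz' : z' ∈ cubesIn Y)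
    (Jz : ∀ i, J i (z i)) (Jz' : ∀ i, J i (z' i)) :
    f z (cubesIn_subset Y hz) Jz = f z' (cubesIn_subset Y hz') Jz' := by
  classical
  have up : ∀ z : Lattice D, ∀ hz : z ∈ cubesIn Y, ∀ Jz : ∀ i, J i (z i),
      ∀ T : Finset (Fin D), (∀ i ∈ T, J i (z i + 1)) → ∀ w : Lattice D,
        w = z + (fun i => if i ∈ T then 1 else 0) → ∀ h1 h2,
          f z (cubesIn_subset Y hz) Jz = f w h1 h2 := by
    intro z hz Jz T
    induction T using Finset.induction_on with
    | empty =>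
      intro _ w hw h1 h2
      have : w = z := by rw [hw]; ext i; simp
      subst this; rfl
    | insert j T hj ih =>
      intro hT w hw h1 h2
      let w' : Lattice D := z + (fun i => if i ∈ T then 1 else 0)
      have hw' : w' ∈ Y := hz ⟨fun i => by
          simp only [w', Pi.add_apply]; split_ifs <;> omega, fun i => by
          simp only [w', Pi.add_apply, Pi.one_apply]; split_ifs <;> omega⟩
      have hJ' : ∀ i, J i (w' i) := by
        intro i
        by_cases hi : i ∈ T
        · simpa [w', hi] using hT i (Finset.mem_insert_of_mem hi)
        · simpa [w', hi] using Jz i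
      have e1 := ih (fun i hi => hT i (Finset.mem_insert_of_mem hi)) w' rfl hw' hJ'
      have e2 : w = w' + unitVec j := by
        rw [hw]; ext i
        by_cases hi : i = j
        · subst hi; simp [w', hj]
        · simp [w', hi]
      subst e2
      rw [e1]
      exact hf _ _ _ _ _ _
  have main : ∀ z z' : Lattice D, ∀ hz : z ∈ cubesIn Y, ∀ Jz : ∀ i, J i (z i),
      (∀ i, J i (z' i)) → ∀ h1 h2, f z (cubesIn_subset Y hz) Jz = f (z ⊔ z') h1 h2 := by
    intro z z' hz Jz Jz' h1 h2
    refine up z hz Jz (Finset.univ.filter fun i => z i < z' i) ?_ _ ?_ _ _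
    · intro i hi
      have h3 := hJ i _ _ (Jz i) (Jz' i)
      have h4 : z i < z' i := by simpa using hi
      have : z i + 1 = z' i := by omega
      rw [this]; exact Jz' i
    · ext i
      have h3 := hJ i _ _ (Jz i) (Jz' i)
      by_cases hi : z i < z' i
      · simp only [Pi.sup_apply, Pi.add_apply, Finset.mem_filter, Finset.mem_univ, true_and,
          if_pos hi]
        rw [sup_eq_right.2 hi.le]; omega
      · simp only [Pi.sup_apply, Pi.add_apply, Finset.mem_filter, Finset.mem_univ, true_and,
          if_neg hi]
        rw [sup_eq_left.2 (not_lt.1 hi)]; omega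
  have hJs : ∀ i, J i ((z ⊔ z') i) := by
    intro i
    rcases le_total (z i) (z' i) with h | h
    · rw [Pi.sup_apply, sup_eq_right.2 h]; exact Jz' i
    · rw [Pi.sup_apply, sup_eq_left.2 h]; exact Jz i
  have hYs : z ⊔ z' ∈ Y := hz ⟨le_sup_left, fun i => by
    have h3 := hJ i _ _ (Jz i) (Jz' i)
    simp only [Pi.sup_apply, Pi.add_apply, Pi.one_apply]
    exact sup_le (by omega) h3⟩
  rw [main z z' hz Jz Jz' hYs hJs]
  have h := main z' z hz' Jz' Jz (by rw [sup_comm]; exact hYs) (by rw [sup_comm]; exact hJs)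
  rw [h]
  congr 1
  exact sup_comm _ _

theorem Face.inCube_close (F : Face D) (i : Fin D) (m n : ℤ)
    (hm : F.base i = m ∨ (i ∉ F.dirs ∧ F.base i = m + 1))
    (hn : F.base i = n ∨ (i ∉ F.dirs ∧ F.base i = n + 1)) : n ≤ m + 1 := by
  omega

theorem cube_close (p : Fin D → ℝ) (i : Fin D) (m n : ℤ)
    (hm : (m : ℝ) ≤ p i ∧ p i ≤ m + 1) (hn : (n : ℝ) ≤ p i ∧ p i ≤ n + 1) : n ≤ m + 1 := by
  have : (n : ℝ) ≤ m + 1 := hn.1.trans hm.2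
  exact_mod_cast this

theorem isClosed_unitCube (z : Lattice D) : IsClosed (unitCube z) := by
  have : unitCube z = Icc (fun i => (z i : ℝ)) (fun i => (z i : ℝ) + 1) := by
    ext p; simp [unitCube, Pi.le_def, forall_and]
  rw [this]; exact isClosed_Icc

theorem locallyFinite_unitCube : LocallyFinite (fun z : Lattice D => unitCube z) := by
  intro p
  refine ⟨Metric.ball p 1, Metric.ball_mem_nhds p one_pos, ?_⟩
  refine (Set.finite_Icc (fun i => ⌊p i⌋ - 3 : Lattice D) (fun i => ⌊p i⌋ + 3)).subset ?_
  rintro z ⟨x, hx, hxp⟩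
  have hd : ∀ i, |x i - p i| < 1 := fun i => by
    have := (dist_le_pi_dist x p i).trans_lt (Metric.mem_ball.1 hxp)
    rwa [Real.dist_eq] at this
  refine ⟨fun i => ?_, fun i => ?_⟩
  · have h1 := abs_lt.1 (hd i)
    have h2 := hx i
    have h3 := Int.floor_le (p i)
    have h5 : ((⌊p i⌋ : ℤ) : ℝ) - 3 ≤ z i := by linarith
    exact_mod_cast h5
  · have h1 := abs_lt.1 (hd i)
    have h2 := hx i
    have h4 := Int.lt_floor_add_one (p i)
    have h5 : (z i : ℝ) ≤ (⌊p i⌋ : ℤ) + 3 := by linarith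
    exact_mod_cast h5

end Geometry

/-! ### Cubical complexes over `ℝ^D`, their homology and cohomology -/

section Cubical

variable {D : ℕ}

/-- Combinatorial data of a cell complex whose cells are labelled copies of faces of the
canonical cell complex of `ℝ^D`. -/
structure CubicalComplex (D : ℕ) where
  /-- The cells of all dimensions. -/
  Cell : Type u
  /-- The face of `ℝ^D` over which a cell lies. -/
  face : Cell → Face D
  /-- The lower facet in direction `i`. -/
  lower : Fin D → Cell → Cell
  /-- The upper facet in direction `i`. -/
  upper : Fin D → Cell → Cell
  face_lower : ∀ i c, face (lower i c) = (face c).lower i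
  face_upper : ∀ i c, face (upper i c) = (face c).upper i

namespace CubicalComplex

variable (X : CubicalComplex.{u} D) (G : Type w) [AddCommGroup G]

/-- The dimension of a cell. -/
def dim (c : X.Cell) : ℕ := (X.face c).dirs.card

/-- The sign with which the upper facet in direction `i` occurs in the boundary of `c`. -/
def sign (c : X.Cell) (i : Fin D) : ℤ := (-1) ^ ((X.face c).dirs.filter (· < i)).card

/-- The cubical boundary operator on `G`-valued chains of all dimensions. -/
noncomputable def boundary : (X.Cell →₀ G) →+ (X.Cell →₀ G) :=
  Finsupp.liftAddHom fun c => ∑ i ∈ (X.face c).dirs,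
    X.sign c i • (Finsupp.singleAddHom (X.upper i c) - Finsupp.singleAddHom (X.lower i c))

/-- The cubical coboundary operator on `G`-valued cochains of all dimensions. -/
def coboundary : (X.Cell → G) →+ (X.Cell → G) where
  toFun η c := ∑ i ∈ (X.face c).dirs, X.sign c i • (η (X.upper i c) - η (X.lower i c))
  map_zero' := by ext c; simp
  map_add' η θ := by
    ext c
    simp only [Pi.add_apply, ← Finset.sum_add_distrib, ← smul_add]
    refine Finset.sum_congr rfl fun i _ => ?_
    congr 1; abel

/-- The `k`-chains. -/
def chains (k : ℕ) : AddSubgroup (X.Cell →₀ G) where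
  carrier := {x | ∀ c, X.dim c ≠ k → x c = 0}
  zero_mem' := by simp
  add_mem' {x y} hx hy c hc := by simp [hx c hc, hy c hc]
  neg_mem' {x} hx c hc := by simp [hx c hc]

/-- The `k`-cochains. -/
def cochains (k : ℕ) : AddSubgroup (X.Cell → G) where
  carrier := {x | ∀ c, X.dim c ≠ k → x c = 0}
  zero_mem' := by simp
  add_mem' {x y} hx hy c hc := by simp [hx c hc, hy c hc]
  neg_mem' {x} hx c hc := by simp [hx c hc]

/-- The `k`-cycles. -/
noncomputable def cycles (k : ℕ) : AddSubgroup (X.Cell →₀ G) :=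
  X.chains G k ⊓ (X.boundary G).ker

/-- The `k`-boundaries. -/
noncomputable def boundaries (k : ℕ) : AddSubgroup (X.Cell →₀ G) :=
  (X.chains G (k + 1)).map (X.boundary G)

/-- The `k`-cocycles. -/
def cocycles (k : ℕ) : AddSubgroup (X.Cell → G) :=
  X.cochains G k ⊓ (X.coboundary G).ker

/-- The `k`-coboundaries. -/
def coboundaries : ℕ → AddSubgroup (X.Cell → G)
  | 0 => ⊥
  | k + 1 => (X.cochains G k).map (X.coboundary G)

/-- The `k`-th homology group with coefficients in `G`. -/
abbrev Homology (k : ℕ) : Type _ :=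
  (X.cycles G k) ⧸ (X.boundaries G k).addSubgroupOf (X.cycles G k)

/-- The `k`-th cohomology group with coefficients in `G`. -/
abbrev Cohomology (k : ℕ) : Type _ :=
  (X.cocycles G k) ⧸ (X.coboundaries G k).addSubgroupOf (X.cocycles G k)

variable {X}

/-- A cellular map lying over the identity of `ℝ^D`. -/
structure Hom (X : CubicalComplex.{u} D) (Y : CubicalComplex.{v} D) where
  toFun : X.Cell → Y.Cell
  face_eq : ∀ c, Y.face (toFun c) = X.face c
  map_lower : ∀ i c, i ∈ (X.face c).dirs → toFun (X.lower i c) = Y.lower i (toFun c)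
  map_upper : ∀ i c, i ∈ (X.face c).dirs → toFun (X.upper i c) = Y.upper i (toFun c)

namespace Hom

variable {Y : CubicalComplex.{v} D}

theorem dim_eq (f : Hom X Y) (c : X.Cell) : Y.dim (f.toFun c) = X.dim c := by
  simp [CubicalComplex.dim, f.face_eq]

/-- The induced map on chains. -/
noncomputable def chainMap (f : Hom X Y) : (X.Cell →₀ G) →+ (Y.Cell →₀ G) :=
  Finsupp.mapDomain.addMonoidHom f.toFun

/-- The induced map on cochains. -/
def cochainMap (f : Hom X Y) : (Y.Cell → G) →+ (X.Cell → G) where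
  toFun η := η ∘ f.toFun
  map_zero' := rfl
  map_add' _ _ := rfl

theorem boundary_chainMap (f : Hom X Y) (x : X.Cell →₀ G) :
    Y.boundary G (f.chainMap G x) = f.chainMap G (X.boundary G x) := by
  have : (Y.boundary G).comp (f.chainMap G) = (f.chainMap G).comp (X.boundary G) := by
    refine Finsupp.addHom_ext fun c g => ?_
    simp only [AddMonoidHom.comp_apply, chainMap, boundary, Finsupp.mapDomain.addMonoidHom_apply,
      Finsupp.mapDomain_single, Finsupp.liftAddHom_apply_single, AddMonoidHom.finsetSum_apply,
      AddMonoidHom.smul_apply, AddMonoidHom.sub_apply, Finsupp.singleAddHom_apply, f.face_eq]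
    rw [Finsupp.mapDomain_finsetSum]
    refine Finset.sum_congr rfl fun i hi => ?_
    have hs : Y.sign (f.toFun c) i = X.sign c i := by
      simp [CubicalComplex.sign, f.face_eq]
    rw [hs, ← f.map_lower i c hi, ← f.map_upper i c hi]
    change _ = Finsupp.mapDomain.addMonoidHom f.toFun _
    rw [map_zsmul, map_sub]
    simp [Finsupp.mapDomain_single]
  exact DFunLike.congr_fun this x

theorem coboundary_cochainMap (f : Hom X Y) (η : Y.Cell → G) :
    X.coboundary G (f.cochainMap G η) = f.cochainMap G (Y.coboundary G η) := by
  ext c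
  simp only [coboundary, cochainMap, AddMonoidHom.coe_mk, ZeroHom.coe_mk, Function.comp_apply,
    f.face_eq]
  refine Finset.sum_congr rfl fun i hi => ?_
  have hs : Y.sign (f.toFun c) i = X.sign c i := by
    simp [CubicalComplex.sign, f.face_eq]
  rw [hs, f.map_lower i c hi, f.map_upper i c hi]

theorem chainMap_mem_chains (f : Hom X Y) {k : ℕ} {x : X.Cell →₀ G} (hx : x ∈ X.chains G k) :
    f.chainMap G x ∈ Y.chains G k := by
  classical
  intro c hc
  by_contra hne
  have h1 : c ∈ (Finsupp.mapDomain f.toFun x).support := Finsupp.mem_support_iff.2 hne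
  obtain ⟨c', hc', rfl⟩ := Finset.mem_image.1 (Finsupp.mapDomain_support h1)
  refine Finsupp.mem_support_iff.1 hc' (hx c' ?_)
  rwa [f.dim_eq] at hc

theorem cochainMap_mem_cochains (f : Hom X Y) {k : ℕ} {η : Y.Cell → G}
    (hη : η ∈ Y.cochains G k) : f.cochainMap G η ∈ X.cochains G k := by
  intro c hc
  exact hη _ (by rwa [f.dim_eq])

theorem chainMap_mem_cycles (f : Hom X Y) {k : ℕ} {x : X.Cell →₀ G} (hx : x ∈ X.cycles G k) :
    f.chainMap G x ∈ Y.cycles G k := by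
  refine ⟨f.chainMap_mem_chains G hx.1, ?_⟩
  have : X.boundary G x = 0 := hx.2
  change Y.boundary G (f.chainMap G x) = 0
  rw [boundary_chainMap, this, map_zero]

theorem cochainMap_mem_cocycles (f : Hom X Y) {k : ℕ} {η : Y.Cell → G}
    (hη : η ∈ Y.cocycles G k) : f.cochainMap G η ∈ X.cocycles G k := by
  refine ⟨f.cochainMap_mem_cochains G hη.1, ?_⟩
  have : Y.coboundary G η = 0 := hη.2
  change X.coboundary G (f.cochainMap G η) = 0
  rw [coboundary_cochainMap, this, map_zero]

theorem chainMap_mem_boundaries (f : Hom X Y) {k : ℕ} {x : X.Cell →₀ G}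
    (hx : x ∈ X.boundaries G k) : f.chainMap G x ∈ Y.boundaries G k := by
  obtain ⟨y, hy, rfl⟩ := hx
  exact ⟨f.chainMap G y, f.chainMap_mem_chains G hy, boundary_chainMap G f y⟩

theorem cochainMap_mem_coboundaries (f : Hom X Y) {k : ℕ} {η : Y.Cell → G}
    (hη : η ∈ Y.coboundaries G k) : f.cochainMap G η ∈ X.coboundaries G k := by
  cases k with
  | zero =>
    have : η = 0 := hη
    rw [this, map_zero]; exact AddSubgroup.zero_mem _
  | succ k =>
    obtain ⟨y, hy, rfl⟩ := hη
    exact ⟨f.cochainMap G y, f.cochainMap_mem_cochains G hy, coboundary_cochainMap G f y⟩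

/-- The induced map on cycles. -/
noncomputable def cyclesMap (f : Hom X Y) (k : ℕ) : X.cycles G k →+ Y.cycles G k :=
  ((f.chainMap G).comp (X.cycles G k).subtype).codRestrict _
    fun x => f.chainMap_mem_cycles G x.2

/-- The induced map on cocycles. -/
def cocyclesMap (f : Hom X Y) (k : ℕ) : Y.cocycles G k →+ X.cocycles G k :=
  ((f.cochainMap G).comp (Y.cocycles G k).subtype).codRestrict _
    fun x => f.cochainMap_mem_cocycles G x.2

/-- The induced map on homology. -/
noncomputable def homologyMap (f : Hom X Y) (k : ℕ) : X.Homology G k →+ Y.Homology G k :=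
  QuotientAddGroup.map _ _ (f.cyclesMap G k) fun _ hx => f.chainMap_mem_boundaries G hx

/-- The induced map on cohomology. -/
def cohomologyMap (f : Hom X Y) (k : ℕ) : Y.Cohomology G k →+ X.Cohomology G k :=
  QuotientAddGroup.map _ _ (f.cocyclesMap G k) fun _ hx => f.cochainMap_mem_coboundaries G hx

theorem homologyMap_square {X : CubicalComplex.{u} D} {Y : CubicalComplex.{v} D}
    {Y' : CubicalComplex.{v'} D} {Z : CubicalComplex.{w} D} {G : Type*} [AddCommGroup G]
    (f : Hom X Y) (g : Hom Y Z) (f' : Hom X Y') (g' : Hom Y' Z)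
    (h : ∀ c, g.toFun (f.toFun c) = g'.toFun (f'.toFun c)) (k : ℕ) (x : X.Homology G k) :
    g.homologyMap G k (f.homologyMap G k x) = g'.homologyMap G k (f'.homologyMap G k x) := by
  induction x using QuotientAddGroup.induction_on with
  | H x =>
    refine congrArg (QuotientAddGroup.mk (s := (Z.boundaries G k).addSubgroupOf (Z.cycles G k)))
      (Subtype.ext ?_)
    change Finsupp.mapDomain g.toFun (Finsupp.mapDomain f.toFun x.1)
      = Finsupp.mapDomain g'.toFun (Finsupp.mapDomain f'.toFun x.1)
    rw [← Finsupp.mapDomain_comp, ← Finsupp.mapDomain_comp]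
    congr 1
    exact funext h

theorem cohomologyMap_square {X : CubicalComplex.{u} D} {Y : CubicalComplex.{v} D}
    {Y' : CubicalComplex.{v'} D} {Z : CubicalComplex.{w} D} {G : Type*} [AddCommGroup G]
    (f : Hom X Y) (g : Hom Y Z) (f' : Hom X Y') (g' : Hom Y' Z)
    (h : ∀ c, g.toFun (f.toFun c) = g'.toFun (f'.toFun c)) (k : ℕ) (x : Z.Cohomology G k) :
    f.cohomologyMap G k (g.cohomologyMap G k x) =
      f'.cohomologyMap G k (g'.cohomologyMap G k x) := by
  induction x using QuotientAddGroup.induction_on with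
  | H x =>
    refine congrArg
      (QuotientAddGroup.mk (s := (X.coboundaries G k).addSubgroupOf (X.cocycles G k)))
      (Subtype.ext ?_)
    exact funext fun c => congrArg x.1 (h c)

end Hom

end CubicalComplex

/-- The subcomplex of `ℝ^D` formed by the unit cubes all of whose corners lie in `Y`, that is, the
canonical cell structure of `thicken Y`. -/
def regionComplex (Y : Set (Lattice D)) : CubicalComplex.{0} D where
  Cell := {F : Face D // ∃ z ∈ cubesIn Y, F.InCube z}
  face c := c.1
  lower i c := ⟨c.1.lower i, c.2.imp fun _ h => ⟨h.1, h.2.lower i⟩⟩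
  upper i c := ⟨c.1.upper i, c.2.imp fun _ h => ⟨h.1, h.2.upper i⟩⟩
  face_lower _ _ := rfl
  face_upper _ _ := rfl

/-- The inclusion of subcomplexes of `ℝ^D`. -/
def regionIncl {Y Y' : Set (Lattice D)} (h : Y ⊆ Y') :
    CubicalComplex.Hom (regionComplex Y) (regionComplex Y') where
  toFun c := ⟨c.1, c.2.imp fun _ hz => ⟨cubesIn_mono h hz.1, hz.2⟩⟩
  face_eq _ := rfl
  map_lower _ _ _ := rfl
  map_upper _ _ _ := rfl

end Cubical

/-! ### The tile complexes `X_r` -/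

section Tiles

variable {D : ℕ} {A : Type u} {S : Set (Config D A)}

/-- The face-matching rule of the radius `r` Wang representation in direction `d`: the top face of
`b` agrees with the bottom face of `b'`. -/
def EdgeMatch (d : Fin D) {r : ℕ} (b b' : Block D A r) : Prop :=
  ∀ (x : Lattice D) (h : x ∈ box D r) (h' : x + unitVec d ∈ box D r),
    b ⟨x + unitVec d, h'⟩ = b' ⟨x, h⟩

/-- A labelled unit cube: a position together with an admissible `r`-block. -/
abbrev Tile (S : Set (Config D A)) (r : ℕ) := Lattice D × Adm S r

/-- `t'` is the neighbour of `t` in direction `d` and the two labels match. -/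
def Glued {r : ℕ} (d : Fin D) (t t' : Tile S r) : Prop :=
  t'.1 = t.1 + unitVec d ∧ EdgeMatch d t.2.1 t'.2.1

/-- The gluing of points of labelled unit cubes along matching faces. -/
def PointGlue {r : ℕ} (x y : Σ t : Tile S r, unitCube t.1) : Prop :=
  (∃ d, Glued d x.1 y.1) ∧ x.2.1 = y.2.1

/-- The tile complex `X_r` as a topological space: the disjoint union of all labelled unit cubes,
modulo gluing of matching faces. -/
def TileSpace (S : Set (Config D A)) (r : ℕ) : Type u := Quot (PointGlue (S := S) (r := r))

instance (S : Set (Config D A)) (r : ℕ) : TopologicalSpace (TileSpace S r) :=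
  inferInstanceAs (TopologicalSpace (Quot _))

/-- The gluing of faces of labelled unit cubes along matching facets. -/
def FaceGlue {r : ℕ} (x y : {x : Tile S r × Face D // x.2.InCube x.1.1}) : Prop :=
  (∃ d, Glued d x.1.1 y.1.1) ∧ x.1.2 = y.1.2

/-- The cell structure of the tile complex `X_r`. -/
def tileComplex (S : Set (Config D A)) (r : ℕ) : CubicalComplex.{u} D where
  Cell := Quot (FaceGlue (S := S) (r := r))
  face := Quot.lift (fun x => x.1.2) fun _ _ h => h.2
  lower i := Quot.map (fun x => ⟨(x.1.1, x.1.2.lower i), x.2.lower i⟩)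
    fun _ _ h => ⟨h.1, congrArg (Face.lower i) h.2⟩
  upper i := Quot.map (fun x => ⟨(x.1.1, x.1.2.upper i), x.2.upper i⟩)
    fun _ _ h => ⟨h.1, congrArg (Face.upper i) h.2⟩
  face_lower i c := by induction c using Quot.ind; rfl
  face_upper i c := by induction c using Quot.ind; rfl

/-- A map of labels which respects the matching rules. -/
structure BlockMap (S : Set (Config D A)) (r s : ℕ) where
  toFun : Adm S r → Adm S s
  map_match : ∀ d b b', EdgeMatch d b.1 b'.1 → EdgeMatch d (toFun b).1 (toFun b').1

namespace BlockMap

variable {r s : ℕ}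

/-- The cellular map of tile complexes which changes the labels of cubes. -/
def spaceMap (g : BlockMap S r s) : C(TileSpace S r, TileSpace S s) where
  toFun := Quot.map (fun x => ⟨(x.1.1, g.toFun x.1.2), x.2⟩)
    fun _ _ h => ⟨h.1.imp fun d hd => ⟨hd.1, g.map_match d _ _ hd.2⟩, h.2⟩
  continuous_toFun := by
    refine continuous_quot_lift _ (continuous_quot_mk.comp ?_)
    exact continuous_sigma fun t => (continuous_sigmaMk :
      Continuous (Sigma.mk (β := fun t : Tile S s => unitCube t.1) (t.1, g.toFun t.2)))

/-- The same map on cells. -/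
def cellMap (g : BlockMap S r s) : CubicalComplex.Hom (tileComplex S r) (tileComplex S s) where
  toFun := Quot.map (fun x => ⟨((x.1.1.1, g.toFun x.1.1.2), x.1.2), x.2⟩)
    fun _ _ h => ⟨h.1.imp fun d hd => ⟨hd.1, g.map_match d _ _ hd.2⟩, h.2⟩
  face_eq c := by induction c using Quot.ind; rfl
  map_lower i c _ := by induction c using Quot.ind; rfl
  map_upper i c _ := by induction c using Quot.ind; rfl

theorem spaceMap_square {r s s' t : ℕ} (g : BlockMap S r s) (h : BlockMap S s t)
    (g' : BlockMap S r s') (h' : BlockMap S s' t)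
    (e : ∀ b, h.toFun (g.toFun b) = h'.toFun (g'.toFun b)) (x : TileSpace S r) :
    h.spaceMap (g.spaceMap x) = h'.spaceMap (g'.spaceMap x) := by
  induction x using Quot.ind with
  | mk x =>
    obtain ⟨⟨z, b⟩, p⟩ := x
    change Quot.mk _ (⟨(z, h.toFun (g.toFun b)), p⟩ : Σ t : Tile S t, unitCube t.1)
      = Quot.mk _ ⟨(z, h'.toFun (g'.toFun b)), p⟩
    rw [e]

theorem cellMap_square {r s s' t : ℕ} (g : BlockMap S r s) (h : BlockMap S s t)
    (g' : BlockMap S r s') (h' : BlockMap S s' t)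
    (e : ∀ b, h.toFun (g.toFun b) = h'.toFun (g'.toFun b)) (x : (tileComplex S r).Cell) :
    h.cellMap.toFun (g.cellMap.toFun x) = h'.cellMap.toFun (g'.cellMap.toFun x) := by
  induction x using Quot.ind with
  | mk x =>
    obtain ⟨⟨⟨z, b⟩, F⟩, hF⟩ := x
    change Quot.mk _ (⟨((z, h.toFun (g.toFun b)), F), hF⟩ :
        {x : Tile S t × Face D // x.2.InCube x.1.1})
      = Quot.mk _ ⟨((z, h'.toFun (g'.toFun b)), F), hF⟩
    rw [e]

end BlockMap

/-- The map of labels inducing `ζ : X_s → X_r`, for `r ≤ s`. -/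
def restrictMap (S : Set (Config D A)) {r s : ℕ} (h : r ≤ s) : BlockMap S s r where
  toFun b := ⟨Block.restrict h b.1, Adm.restrict h b.2⟩
  map_match _ _ _ hb x hx hx' := hb x (box_mono h hx) (box_mono h hx')

theorem box_add {r q : ℕ} {x y : Lattice D} (hx : x ∈ box D r) (hy : y ∈ box D q) :
    x + y ∈ box D (r + q) := fun i => by
  have h1 := abs_le.1 (hx i)
  have h2 := abs_le.1 (hy i)
  rw [Pi.add_apply, abs_le]
  push_cast
  constructor <;> linarith

/-- The map of labels inducing `Φ_* : X_(r+q) → X_r`: an admissible block of radius `r + q` is sent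
to the central block of radius `r` of its image under `Φ`. -/
noncomputable def caMap {Φ : Config D A → Config D A} {q : ℕ} (hq : HasRadius Φ q)
    (hS : MapsTo Φ S S) (r : ℕ) : BlockMap S (r + q) r where
  toFun b := ⟨blockAt (Φ b.2.choose) r 0, Φ b.2.choose, hS b.2.choose_spec.1, rfl⟩
  map_match d b b' hb x hx hx' := by
    have e1 := b.2.choose_spec.2
    have e2 := b'.2.choose_spec.2
    refine hq _ _ _ _ fun y hy => ?_
    have h1 := congrFun e1 ⟨x + unitVec d + y, box_add hx' hy⟩
    have h2 := congrFun e2 ⟨x + y, box_add hx hy⟩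
    have e3 : x + y + unitVec d = x + unitVec d + y := by abel
    have h3 := hb (x + y) (box_add hx hy) (by rw [e3]; exact box_add hx' hy)
    simp only [blockAt] at h1 h2
    have h4 : b.1 ⟨x + unitVec d + y, box_add hx' hy⟩
        = b.1 ⟨x + y + unitVec d, by rw [e3]; exact box_add hx' hy⟩ :=
      congrArg b.1 (Subtype.ext e3.symm)
    rw [add_assoc 0, h1, add_assoc 0, h2, h4, h3]

theorem caMap_blockAt {Φ : Config D A → Config D A} {q : ℕ} (hq : HasRadius Φ q)
    (hS : MapsTo Φ S S) (r : ℕ) {c : Config D A} (hc : c ∈ S) :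
    (caMap hq hS r).toFun ⟨blockAt c (r + q) 0, c, hc, rfl⟩
      = ⟨blockAt (Φ c) r 0, Φ c, hS hc, rfl⟩ := by
  refine Subtype.ext (funext fun x => ?_)
  have hb : blockAt c (r + q) 0 ∈ Adm S (r + q) := ⟨c, hc, rfl⟩
  have e1 : blockAt hb.choose (r + q) 0 = blockAt c (r + q) 0 := hb.choose_spec.2
  refine hq _ _ _ _ fun y hy => ?_
  have h1 := congrFun e1 ⟨x + y, box_add x.2 hy⟩
  simpa [blockAt, add_assoc] using h1

/-- The maps induced by `Φ` commute with the restriction maps. -/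
theorem caMap_restrict {Φ : Config D A → Config D A} {q : ℕ} (hq : HasRadius Φ q)
    (hS : MapsTo Φ S S) {r s : ℕ} (h : r ≤ s) (b : Adm S (s + q)) :
    (restrictMap S h).toFun ((caMap hq hS s).toFun b)
      = (caMap hq hS r).toFun ((restrictMap S (Nat.add_le_add_right h q)).toFun b) := by
  obtain ⟨_, c, hc, rfl⟩ := b
  have e1 := caMap_blockAt hq hS s hc
  have e2 := caMap_blockAt hq hS r hc
  change _ = (caMap hq hS r).toFun ⟨blockAt c (r + q) 0, c, hc, rfl⟩
  rw [e2]
  change (restrictMap S h).toFun ((caMap hq hS s).toFun ⟨blockAt c (s + q) 0, c, hc, rfl⟩) = _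
  rw [e1]
  rfl

/-- The base vertex `x_r(c)` of `X_r`: the corner over `0` of the cube at `0` labelled by the
central `r`-block of `c`. -/
def basePt (c : S) (r : ℕ) : TileSpace S r :=
  Quot.mk _ ⟨(0, ⟨blockAt c.1 r 0, c.1, c.2, rfl⟩), ⟨0, fun i => by simp⟩⟩

theorem restrict_basePt (c : S) {r s : ℕ} (h : r ≤ s) :
    (restrictMap S h).spaceMap (basePt c s) = basePt c r := rfl

theorem caMap_basePt {Φ : Config D A → Config D A} {q : ℕ} (hq : HasRadius Φ q)
    (hS : MapsTo Φ S S) (c : S) (r : ℕ) :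
    (caMap hq hS r).spaceMap (basePt c (r + q)) = basePt ⟨Φ c.1, hS c.2⟩ r := by
  have e := caMap_blockAt hq hS r c.2
  change Quot.mk _ (⟨(0, (caMap hq hS r).toFun ⟨blockAt c.1 (r + q) 0, c.1, c.2, rfl⟩), _⟩ :
    Σ t : Tile S r, unitCube t.1) = _
  rw [e]
  rfl

/-! ### The sections determined by a configuration -/

/-- The label which `a` gives to the cube at `z`. -/
def tileAt (a : Config D A) (r : ℕ) (z : Lattice D) (hz : z ∈ unflawed S a r) : Tile S r :=
  (z, ⟨blockAt a r z, hz⟩)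

theorem glued_tileAt (a : Config D A) (r : ℕ) (z : Lattice D) (d : Fin D)
    (hz : z ∈ unflawed S a r) (hz' : z + unitVec d ∈ unflawed S a r) :
    Glued d (tileAt a r z hz) (tileAt a r (z + unitVec d) hz') := by
  refine ⟨rfl, fun x _ _ => ?_⟩
  change a (z + (x + unitVec d)) = a (z + unitVec d + x)
  congr 1; abel

/-- The value at `p` of the section of `X_r → ℝ^D` determined by `a`, computed in the cube
at `z`. -/
def sectionAt (a : Config D A) (r : ℕ) (p : Fin D → ℝ) (z : Lattice D)
    (hz : z ∈ unflawed S a r) (hp : p ∈ unitCube z) : TileSpace S r :=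
  Quot.mk _ ⟨tileAt a r z hz, ⟨p, hp⟩⟩

theorem sectionAt_eq (a : Config D A) (r : ℕ) (p : Fin D → ℝ) {z z' : Lattice D}
    (hz : z ∈ cubesIn (unflawed S a r)) (hz' : z' ∈ cubesIn (unflawed S a r))
    (hp : p ∈ unitCube z) (hp' : p ∈ unitCube z') :
    sectionAt a r p z (cubesIn_subset _ hz) hp = sectionAt a r p z' (cubesIn_subset _ hz') hp' :=
  chain_eq (cube_close p) (sectionAt a r p)
    (fun w d h1 _ h3 _ => Quot.sound ⟨⟨d, glued_tileAt a r w d h1 h3⟩, rfl⟩) hz hz' hp hp'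

/-- The section over the unflawed region determined by `a`, as a map of spaces. -/
noncomputable def sectionMap (S : Set (Config D A)) (a : Config D A) (r : ℕ) :
    C(thicken (unflawed S a r), TileSpace S r) where
  toFun p := sectionAt a r p.1 p.2.choose (cubesIn_subset _ p.2.choose_spec.1) p.2.choose_spec.2
  continuous_toFun := by
    have hlf : LocallyFinite fun z : cubesIn (unflawed S a r) =>
        ((fun p : thicken (unflawed S a r) => p.1) ⁻¹' unitCube z.1) :=
      (locallyFinite_unitCube.preimage_continuous continuous_subtype_val).comp_injective
        Subtype.val_injective
    refine hlf.continuous ?_ (fun z => (isClosed_unitCube z.1).preimage continuous_subtype_val) ?_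
    · refine eq_univ_of_forall fun p => ?_
      obtain ⟨z, hz, hp⟩ := p.2
      exact mem_iUnion.2 ⟨⟨z, hz⟩, hp⟩
    · intro z
      rw [continuousOn_iff_continuous_domRestrict]
      have hc : Continuous fun p : ((fun p : thicken (unflawed S a r) => p.1) ⁻¹' unitCube z.1) =>
          sectionAt a r p.1.1 z.1 (cubesIn_subset _ z.2) p.2 :=
        continuous_quot_mk.comp (continuous_sigmaMk.comp
          (Continuous.subtype_mk (continuous_subtype_val.comp continuous_subtype_val) _))
      convert hc using 1
      ext p
      exact sectionAt_eq a r p.1.1 p.1.2.choose_spec.1 z.2 p.1.2.choose_spec.2 p.2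

theorem sectionMap_apply (a : Config D A) (r : ℕ) (p : thicken (unflawed S a r)) {z : Lattice D}
    (hz : z ∈ cubesIn (unflawed S a r)) (hp : p.1 ∈ unitCube z) :
    sectionMap S a r p = sectionAt a r p.1 z (cubesIn_subset _ hz) hp :=
  sectionAt_eq a r p.1 p.2.choose_spec.1 hz p.2.choose_spec.2 hp

/-- The sections for different radii are compatible. -/
theorem restrict_sectionMap (a : Config D A) {r s : ℕ} (h : r ≤ s)
    (p : thicken (unflawed S a s)) :
    (restrictMap S h).spaceMap (sectionMap S a s p)
      = sectionMap S a r ⟨p.1, thicken_mono (unflawed_anti S a h) p.2⟩ := by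
  obtain ⟨z, hz, hp⟩ := p.2
  rw [sectionMap_apply a s p hz hp,
    sectionMap_apply a r _ (cubesIn_mono (unflawed_anti S a h) hz) hp]
  rfl

/-- The value at the face `F` of the section of `X_r → ℝ^D` determined by `a`, computed in the
cube at `z`. -/
def cellAt (a : Config D A) (r : ℕ) (F : Face D) (z : Lattice D)
    (hz : z ∈ unflawed S a r) (hF : F.InCube z) : (tileComplex S r).Cell :=
  Quot.mk _ ⟨(tileAt a r z hz, F), hF⟩

theorem cellAt_eq (a : Config D A) (r : ℕ) (F : Face D) {z z' : Lattice D}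
    (hz : z ∈ cubesIn (unflawed S a r)) (hz' : z' ∈ cubesIn (unflawed S a r))
    (hF : F.InCube z) (hF' : F.InCube z') :
    cellAt a r F z (cubesIn_subset _ hz) hF = cellAt a r F z' (cubesIn_subset _ hz') hF' :=
  chain_eq F.inCube_close (cellAt a r F)
    (fun w d h1 _ h3 _ => Quot.sound ⟨⟨d, glued_tileAt a r w d h1 h3⟩, rfl⟩) hz hz' hF hF'

/-- The section over the unflawed region determined by `a`, as a map of cells. -/
noncomputable def sectionHom (S : Set (Config D A)) (a : Config D A) (r : ℕ) :
    CubicalComplex.Hom (regionComplex (unflawed S a r)) (tileComplex S r) where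
  toFun c := cellAt a r c.1 c.2.choose (cubesIn_subset _ c.2.choose_spec.1) c.2.choose_spec.2
  face_eq _ := rfl
  map_lower i c _ := cellAt_eq a r (c.1.lower i)
    ((regionComplex (unflawed S a r)).lower i c).2.choose_spec.1 c.2.choose_spec.1
    ((regionComplex (unflawed S a r)).lower i c).2.choose_spec.2 (c.2.choose_spec.2.lower i)
  map_upper i c _ := cellAt_eq a r (c.1.upper i)
    ((regionComplex (unflawed S a r)).upper i c).2.choose_spec.1 c.2.choose_spec.1
    ((regionComplex (unflawed S a r)).upper i c).2.choose_spec.2 (c.2.choose_spec.2.upper i)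

theorem restrict_sectionHom (a : Config D A) {r s : ℕ} (h : r ≤ s)
    (c : (regionComplex (unflawed S a s)).Cell) :
    (restrictMap S h).cellMap.toFun ((sectionHom S a s).toFun c)
      = (sectionHom S a r).toFun ((regionIncl (unflawed_anti S a h)).toFun c) :=
  cellAt_eq a r c.1 (cubesIn_mono (unflawed_anti S a h) c.2.choose_spec.1)
    ((regionIncl (unflawed_anti S a h)).toFun c).2.choose_spec.1 c.2.choose_spec.2
    ((regionIncl (unflawed_anti S a h)).toFun c).2.choose_spec.2

end Tiles

/-! ### Homotopy groups -/

section Homotopy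

variable {X : Type u} [TopologicalSpace X] {Y : Type v} [TopologicalSpace Y]
  {Z : Type w} [TopologicalSpace Z] {k : ℕ}

/-- Composition of a `k`-dimensional loop with a pointed continuous map. -/
def mapLoop (f : C(X, Y)) {x : X} {y : Y} (h : f x = y) (g : GenLoop (Fin k) X x) :
    GenLoop (Fin k) Y y :=
  ⟨f.comp g.1, fun p hp => by
    change f (g p) = y
    rw [GenLoop.boundary g p hp, h]⟩

/-- The map induced on `k`-th homotopy groups by a pointed continuous map. -/
def piMap (f : C(X, Y)) {x : X} {y : Y} (h : f x = y) :
    HomotopyGroup (Fin k) X x → HomotopyGroup (Fin k) Y y :=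
  Quotient.map (mapLoop f h) fun _ _ hg => hg.comp_continuousMap f

theorem piMap_square {Y' : Type v} [TopologicalSpace Y'] {x : X} {y : Y} {y' : Y'} {z : Z}
    (f : C(X, Y)) (g : C(Y, Z)) (f' : C(X, Y')) (g' : C(Y', Z))
    (hf : f x = y) (hg : g y = z) (hf' : f' x = y') (hg' : g' y' = z)
    (e : ∀ x, g (f x) = g' (f' x)) (a : HomotopyGroup (Fin k) X x) :
    piMap g hg (piMap f hf a) = piMap g' hg' (piMap f' hf' a) := by
  induction a using Quotient.inductionOn with
  | h a =>
    exact congrArg (Quotient.mk _) (GenLoop.ext _ _ fun p => e (a p))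

/-- A base ray in `Y`, defined on a final segment of `[0,∞)`. -/
structure Ray (Y : Type v) [TopologicalSpace Y] where
  dom : Set ℝ≥0
  upper : IsUpperSet dom
  pt : dom → Y
  continuous_pt : Continuous pt

/-- The image of a base ray. -/
def Ray.map (f : C(X, Y)) (ρ : Ray X) : Ray Y :=
  ⟨ρ.dom, ρ.upper, f ∘ ρ.pt, f.continuous.comp ρ.continuous_pt⟩

/-- A `k`-dimensional loop based at `ρ(t)` and one based at `ρ(t')` are identified when the second
is the transport of the first along the segment of `ρ` from `t` to `t'`: there is a homotopy
between them which moves the base point along that segment. -/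
def RayRel (k : ℕ) (ρ : Ray Y) (x y : Σ t : ρ.dom, GenLoop (Fin k) Y (ρ.pt t)) : Prop :=
  ∃ H : C(I × (Fin k → I), Y), (∀ p, H (0, p) = x.2 p) ∧ (∀ p, H (1, p) = y.2 p) ∧
    ∀ (s : I), ∀ p ∈ Cube.boundary (Fin k), ∀ t : ρ.dom,
      ((t : ℝ≥0) : ℝ) = (1 - (s : ℝ)) * (x.1 : ℝ≥0) + (s : ℝ) * (y.1 : ℝ≥0) → H (s, p) = ρ.pt t

/-- The homotopy group `π_k(Y, ρ)` based along the ray `ρ` (as a set): it is `π_k(Y, ρ(t))` for any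
`t`, these being identified with each other along segments of `ρ`. -/
def RayPi (k : ℕ) (Y : Type v) [TopologicalSpace Y] (ρ : Ray Y) : Type v := Quot (RayRel k ρ)

/-- The neutral element of `π_k(Y, ρ)`. -/
def RayPi.IsOne {ρ : Ray Y} (u : RayPi k Y ρ) : Prop :=
  ∃ t : ρ.dom, u = Quot.mk _ ⟨t, GenLoop.const⟩

/-- The map induced on homotopy groups based along rays by a continuous map that carries one ray
to (a final segment of) the other. -/
def RayPi.map (f : C(X, Y)) {ρ : Ray X} {ρ' : Ray Y} (hd : ρ.dom ⊆ ρ'.dom)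
    (hp : ∀ t : ρ.dom, f (ρ.pt t) = ρ'.pt ⟨t.1, hd t.2⟩) : RayPi k X ρ → RayPi k Y ρ' :=
  Quot.map (fun x => ⟨⟨x.1.1, hd x.1.2⟩, mapLoop f (hp x.1) x.2⟩) (by
    rintro x y ⟨H, h0, h1, hb⟩
    refine ⟨f.comp H, fun p => congrArg f (h0 p), fun p => congrArg f (h1 p),
      fun s p hpb t ht => ?_⟩
    have htd : t.1 ∈ ρ.dom := by
      rcases le_total x.1.1 y.1.1 with hxy | hxy
      · refine ρ.upper ?_ x.1.2
        have hxy' : ((x.1.1 : ℝ≥0) : ℝ) ≤ y.1.1 := by exact_mod_cast hxy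
        have : ((x.1.1 : ℝ≥0) : ℝ) ≤ (t.1 : ℝ≥0) := by
          rw [ht]; nlinarith [s.2.1, s.2.2, mul_nonneg s.2.1 (sub_nonneg.2 hxy')]
        exact_mod_cast this
      · refine ρ.upper ?_ y.1.2
        have hxy' : ((y.1.1 : ℝ≥0) : ℝ) ≤ x.1.1 := by exact_mod_cast hxy
        have : ((y.1.1 : ℝ≥0) : ℝ) ≤ (t.1 : ℝ≥0) := by
          rw [ht]
          nlinarith [s.2.1, s.2.2, mul_nonneg (sub_nonneg.2 s.2.2) (sub_nonneg.2 hxy')]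
        exact_mod_cast this
    have := hb s p hpb ⟨t.1, htd⟩ ht
    change f (H (s, p)) = _
    rw [this]
    exact hp ⟨t.1, htd⟩)

theorem RayPi.map_square {Y' : Type*} [TopologicalSpace Y'] (f : C(X, Y)) (g : C(Y, Z))
    (f' : C(X, Y')) (g' : C(Y', Z)) {ρX : Ray X} {ρY : Ray Y} {ρY' : Ray Y'} {ρZ : Ray Z}
    (h1 : ρX.dom ⊆ ρY.dom) (p1 : ∀ t : ρX.dom, f (ρX.pt t) = ρY.pt ⟨t.1, h1 t.2⟩)
    (h2 : ρY.dom ⊆ ρZ.dom) (p2 : ∀ t : ρY.dom, g (ρY.pt t) = ρZ.pt ⟨t.1, h2 t.2⟩)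
    (h3 : ρX.dom ⊆ ρY'.dom) (p3 : ∀ t : ρX.dom, f' (ρX.pt t) = ρY'.pt ⟨t.1, h3 t.2⟩)
    (h4 : ρY'.dom ⊆ ρZ.dom) (p4 : ∀ t : ρY'.dom, g' (ρY'.pt t) = ρZ.pt ⟨t.1, h4 t.2⟩)
    (e : ∀ x, g (f x) = g' (f' x)) (a : RayPi k X ρX) :
    RayPi.map g h2 p2 (RayPi.map f h1 p1 a) = RayPi.map g' h4 p4 (RayPi.map f' h3 p3 a) := by
  induction a using Quot.ind with
  | mk a =>
    refine congrArg (Quot.mk _) ?_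
    refine congrArg (Sigma.mk _) ?_
    exact GenLoop.ext _ _ fun p => e (a.2 p)

/-- The inverse limit of a sequence of sets. -/
def InvLim (P : ℕ → Type u) (f : ∀ r s, r ≤ s → P s → P r) : Type u :=
  {p : ∀ r, P r // ∀ r s h, f r s h (p s) = p r}

/-- The inverse limit of a sequence of abelian groups. -/
def invLimGroup (P : ℕ → Type u) [∀ r, AddCommGroup (P r)] (f : ∀ r s, r ≤ s → P s →+ P r) :
    AddSubgroup (∀ r, P r) where
  carrier := {p | ∀ r s h, f r s h (p s) = p r}
  zero_mem' r s h := by simp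
  add_mem' {x y} hx hy r s h := by simp [hx r s h, hy r s h]
  neg_mem' {x} hx r s h := by simp [hx r s h]

end Homotopy

/-! ### Projective homotopy groups and homotopy defects -/

section ProjectiveHomotopy

variable {D : ℕ} {A : Type u} {S : Set (Config D A)}

/-- The projective homotopy group `π_k(S, c)` (as a set): the inverse limit of the groups
`π_k(X_r, x_r(c))`. -/
def ProjPi (k : ℕ) (c : S) : Type u :=
  InvLim (fun r => HomotopyGroup (Fin k) (TileSpace S r) (basePt c r))
    fun _ _ h => piMap (restrictMap S h).spaceMap (restrict_basePt c h)

/-- The map `π_k Φ : π_k(S, c) → π_k(S, Φ(c))`. -/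
noncomputable def projPiMap {Φ : Config D A → Config D A} {q : ℕ} (hq : HasRadius Φ q)
    (hS : MapsTo Φ S S) (k : ℕ) (c : S) (u : ProjPi k c) : ProjPi k (⟨Φ c.1, hS c.2⟩ : S) :=
  ⟨fun r => piMap (caMap hq hS r).spaceMap (caMap_basePt hq hS c r) (u.1 (r + q)),
    fun r _ h =>
      (piMap_square _ _ _ (caMap hq hS r).spaceMap _ _ (restrict_basePt c _) _
        (BlockMap.spaceMap_square _ _ _ _ (caMap_restrict hq hS h)) _).trans
      (congrArg _ (u.2 _ _ (Nat.add_le_add_right h q)))⟩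

/-- The projection from the vertices of `X_r` to `ℤ^D` is injective. -/
def VertexInjective (S : Set (Config D A)) (r : ℕ) : Prop :=
  ∀ c c' : (tileComplex S r).Cell, (tileComplex S r).dim c = 0 → (tileComplex S r).dim c' = 0 →
    (tileComplex S r).face c = (tileComplex S r).face c' → c = c'

/-- The map `π_1(X_s, x_s(c)) → π_1(X_r, x_r(c))`, for `r ≤ s`. -/
noncomputable def piOneMap (c : S) {r s : ℕ} (h : r ≤ s) :
    FundamentalGroup (TileSpace S s) (basePt c s) →*
      FundamentalGroup (TileSpace S r) (basePt c r) :=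
  FundamentalGroup.mapOfEq (restrictMap S h).spaceMap (restrict_basePt c h)

/-- `S` is basepoint-free in codimension `k + 1`: the vertices of `X_r` are determined by their
positions for all large `r`, or `S` is weakly mixing and the tower of fundamental groups
`π_1(X_r, x_r(c))` is abelian (when `k = 1`) or trivial (for any `k`) as a pro-group. -/
def IsBasepointFree [TopologicalSpace A] (S : Set (Config D A)) (k : ℕ) : Prop :=
  (∃ r₀, ∀ r, r₀ ≤ r → VertexInjective S r) ∨
  (IsWeaklyMixing S ∧ k = 1 ∧ ∃ c : S, ∀ r, ∃ s, ∃ h : r ≤ s,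
    ∀ u v, piOneMap c h u * piOneMap c h v = piOneMap c h v * piOneMap c h u) ∨
  (IsWeaklyMixing S ∧ ∃ c : S, ∀ r, ∃ s, ∃ h : r ≤ s, ∀ u, piOneMap c h u = 1)

/-- A proper base ray for `a`: a path to infinity which for each `r` eventually stays in the
(thickened) region `G_r(a)`. -/
structure ProperBaseRay (S : Set (Config D A)) (a : Config D A) where
  toFun : ℝ≥0 → Fin D → ℝ
  continuous_toFun : Continuous toFun
  tendsto_norm : Tendsto (fun t => ‖toFun t‖) atTop atTop
  eventually_mem : ∀ r, ∀ᶠ t in atTop, toFun t ∈ thicken (unflawed S a r)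

/-- The final segment of a proper base ray which stays in `G_r(a)`. -/
def ProperBaseRay.rayAt {a : Config D A} (ω : ProperBaseRay S a) (r : ℕ) :
    Ray (thicken (unflawed S a r)) where
  dom := {t | ∀ t', t ≤ t' → ω.toFun t' ∈ thicken (unflawed S a r)}
  upper _ _ h ht t' ht' := ht t' (h.trans ht')
  pt t := ⟨ω.toFun t.1, t.2 t.1 le_rfl⟩
  continuous_pt := (ω.continuous_toFun.comp continuous_subtype_val).subtype_mk _

theorem ProperBaseRay.rayAt_dom {a : Config D A} (ω : ProperBaseRay S a) {r s : ℕ} (h : r ≤ s) :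
    (ω.rayAt s).dom ⊆ (ω.rayAt r).dom :=
  fun _ ht t' ht' => thicken_mono (unflawed_anti S a h) (ht t' ht')

/-- The inclusion of `G_s(a)` into `G_r(a)`, for `r ≤ s`. -/
def regionMap (S : Set (Config D A)) (a : Config D A) {r s : ℕ} (h : r ≤ s) :
    C(thicken (unflawed S a s), thicken (unflawed S a r)) :=
  ⟨fun p => ⟨p.1, thicken_mono (unflawed_anti S a h) p.2⟩, by fun_prop⟩

/-- The group `π_k(G_∞(a), ω)` (as a set): the inverse limit of the groups `π_k(G_r(a), ω)`. -/
def RegionPi (k : ℕ) {a : Config D A} (ω : ProperBaseRay S a) : Type :=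
  InvLim (fun r => RayPi k (thicken (unflawed S a r)) (ω.rayAt r))
    fun _ _ h => RayPi.map (regionMap S a h) (ω.rayAt_dom h) fun _ => rfl

/-- The image in `X_r` of (a final segment of) `ω` under the section determined by `a`. -/
noncomputable def ProperBaseRay.sectionRay {a : Config D A} (ω : ProperBaseRay S a) (r : ℕ) :
    Ray (TileSpace S r) :=
  (ω.rayAt r).map (sectionMap S a r)

theorem ProperBaseRay.sectionRay_dom {a : Config D A} (ω : ProperBaseRay S a) {r s : ℕ}
    (h : r ≤ s) : (ω.sectionRay s).dom ⊆ (ω.sectionRay r).dom :=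
  ω.rayAt_dom h

theorem ProperBaseRay.rayAt_dom_subset {a : Config D A} (ω : ProperBaseRay S a) (r : ℕ) :
    (ω.rayAt r).dom ⊆ (ω.sectionRay r).dom :=
  Subset.refl _

/-- The inverse limit of the groups `π_k(X_r, a_r)`, based along the image of `ω` under the
sections determined by `a`. -/
def ProjPiAlong (k : ℕ) {a : Config D A} (ω : ProperBaseRay S a) : Type u :=
  InvLim (fun r => RayPi k (TileSpace S r) (ω.sectionRay r))
    fun _ _ h => RayPi.map (restrictMap S h).spaceMap (ω.sectionRay_dom h)
      fun _ => restrict_sectionMap a h _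

/-- The `k`-th homotopy signature of `a`. -/
noncomputable def homotopySignature (k : ℕ) {a : Config D A} (ω : ProperBaseRay S a)
    (u : RegionPi k ω) : ProjPiAlong k ω :=
  ⟨fun r => RayPi.map (sectionMap S a r) (ω.rayAt_dom_subset r) (fun _ => rfl) (u.1 r), fun r s h =>
    (RayPi.map_square _ _ (regionMap S a h) (sectionMap S a r) _ _ _ _ (ω.rayAt_dom h)
      (fun _ => rfl) _ _ (fun p => restrict_sectionMap a h p) _).trans
    (congrArg _ (u.2 r s h))⟩

/-- `a` has a homotopy defect of codimension `k + 1`: its `k`-th homotopy signature (along some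
proper base ray) is nontrivial. -/
def HasHomotopyDefect (S : Set (Config D A)) (k : ℕ) (a : Config D A) : Prop :=
  a ∈ slightlyDefective S ∧ ∃ (ω : ProperBaseRay S a) (u : RegionPi k ω) (r : ℕ),
    ¬ ((homotopySignature k ω u).1 r).IsOne

end ProjectiveHomotopy

/-! ### Projective (co)homology groups and (co)homology defects -/

section ProjectiveHomology

variable {D : ℕ} {A : Type u} (S : Set (Config D A)) (G : Type w) [AddCommGroup G] (k : ℕ)

/-- The projective homology group `H_k(S, G)`: the inverse limit of the groups `H_k(X_r, G)`. -/
noncomputable def ProjHomology : AddSubgroup (∀ r, (tileComplex S r).Homology G k) :=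
  invLimGroup (fun r => (tileComplex S r).Homology G k)
    fun _ _ h => (restrictMap S h).cellMap.homologyMap G k

/-- The projective cohomology group `H^k(S, G)`: the direct limit of the groups `H^k(X_r, G)`. -/
abbrev ProjCohomology : Type _ :=
  AddCommGroup.DirectLimit (fun r => (tileComplex S r).Cohomology G k)
    fun _ _ h => (restrictMap S h).cellMap.cohomologyMap G k

/-- The group `H_k(G_∞(a), G)`: the inverse limit of the groups `H_k(G_r(a), G)`. -/
noncomputable def RegionHomology (a : Config D A) :
    AddSubgroup (∀ r, (regionComplex (unflawed S a r)).Homology G k) :=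
  invLimGroup (fun r => (regionComplex (unflawed S a r)).Homology G k)
    fun _ _ h => (regionIncl (unflawed_anti S a h)).homologyMap G k

/-- The group `H^k(G_∞(a), G)`: the direct limit of the groups `H^k(G_r(a), G)`. -/
abbrev RegionCohomology (a : Config D A) : Type _ :=
  AddCommGroup.DirectLimit (fun r => (regionComplex (unflawed S a r)).Cohomology G k)
    fun _ _ h => (regionIncl (unflawed_anti S a h)).cohomologyMap G k

variable {S}

/-- The endomorphism `H_k Φ` of `H_k(S, G)`. -/
noncomputable def projHomologyMap {Φ : Config D A → Config D A} {q : ℕ} (hq : HasRadius Φ q)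
    (hS : MapsTo Φ S S) : ProjHomology S G k →+ ProjHomology S G k where
  toFun u := ⟨fun r => (caMap hq hS r).cellMap.homologyMap G k (u.1 (r + q)), fun r s h =>
    (CubicalComplex.Hom.homologyMap_square _ _ _ _
      (BlockMap.cellMap_square _ _ _ _ (caMap_restrict hq hS h)) _ _).trans
    (congrArg _ (u.2 _ _ (Nat.add_le_add_right h q)))⟩
  map_zero' := Subtype.ext (funext fun _ => map_zero _)
  map_add' _ _ := Subtype.ext (funext fun _ => map_add _ _ _)

/-- The endomorphism `H^k Φ` of `H^k(S, G)`. -/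
noncomputable def projCohomologyMap {Φ : Config D A → Config D A} {q : ℕ} (hq : HasRadius Φ q)
    (hS : MapsTo Φ S S) : ProjCohomology S G k →+ ProjCohomology S G k :=
  AddCommGroup.DirectLimit.lift _ _ _
    (fun r => (AddCommGroup.DirectLimit.of _ _ (r + q)).comp
      ((caMap hq hS r).cellMap.cohomologyMap G k))
    fun r s h x => by
      simp only [AddMonoidHom.comp_apply]
      rw [CubicalComplex.Hom.cohomologyMap_square _ _ _ _
        (BlockMap.cellMap_square _ _ _ _ (caMap_restrict hq hS h))]
      exact AddCommGroup.DirectLimit.of_f (Nat.add_le_add_right h q) _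

variable (S)

/-- The `k`-th homology signature `H_k(G_∞(a), G) → H_k(S, G)` of `a`. -/
noncomputable def homologySignature (a : Config D A) :
    RegionHomology S G k a →+ ProjHomology S G k where
  toFun u := ⟨fun r => (sectionHom S a r).homologyMap G k (u.1 r), fun r s h =>
    (CubicalComplex.Hom.homologyMap_square _ _ _ _ (restrict_sectionHom a h) _ _).trans
    (congrArg _ (u.2 r s h))⟩
  map_zero' := Subtype.ext (funext fun _ => map_zero _)
  map_add' _ _ := Subtype.ext (funext fun _ => map_add _ _ _)

/-- The `k`-th cohomology signature `H^k(S, G) → H^k(G_∞(a), G)` of `a`. -/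
noncomputable def cohomologySignature (a : Config D A) :
    ProjCohomology S G k →+ RegionCohomology S G k a :=
  AddCommGroup.DirectLimit.map (fun r => (sectionHom S a r).cohomologyMap G k) fun r s h =>
    AddMonoidHom.ext fun x =>
      CubicalComplex.Hom.cohomologyMap_square _ _ _ _ (restrict_sectionHom a h) _ _

/-- `a` has a homology defect of codimension `k + 1`. -/
def HasHomologyDefect (a : Config D A) : Prop :=
  a ∈ slightlyDefective S ∧ homologySignature S G k a ≠ 0

/-- `a` has a cohomology defect of codimension `k + 1`. -/
def HasCohomologyDefect (a : Config D A) : Prop :=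
  a ∈ slightlyDefective S ∧ cohomologySignature S G k a ≠ 0

end ProjectiveHomology

end CADefect

open CADefect

/-!
The sections `ς_a` satisfy `Φ_* ∘ ς_a = ς_{Φ(a)}` on `G_{r+q}(a) ⊆ G_r(Φ(a))`, so the signature of
`a`, followed by (or, for cohomology, preceded by) the map that `Φ` induces on the invariants of the
subshift, factors through the signature of `Φ(a)`. If that map is injective (surjective for
cohomology), a nontrivial signature stays nontrivial under `Φ`. A configuration with a nontrivial
signature is never in the subshift: there `G_r(a)` would be all of `ℝ^D`, which is contractible; for
cubical chains this is a Poincaré lemma, obtained by integrating along one coordinate after another.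

For homotopy the base points differ: a loop in `G_r(a)` gives a compatible family of *free* homotopy
classes in the spaces `X_r`, whereas injectivity is assumed at a single `c`. If `π_1` acts trivially
on the tower and the `X_r` are path connected (which follows from weak mixing), such a family comes
from one element of `π_k(S, c)`. If instead vertices are determined by their positions, the subshift
has at most one element, since a vertex of `X_r` with `r ≥ 1` determines the symbol there.
-/

namespace CADefect

/-! ### Free homotopy of loops -/

section CubeExtension

variable {N X : Type*} [TopologicalSpace X]

/-- Affine coordinates on the cube `I^N` in which it is the unit ball of the sup norm. -/
def centered (p : N → I) : N → ℝ := fun i => 2 * (p i : ℝ) - 1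

/-- The retraction of `ℝ^N` onto the cube `I^N`, in the coordinates of `centered`. -/
noncomputable def clampToCube (v : N → ℝ) : N → I :=
  fun i => projIcc 0 1 zero_le_one ((1 + v i) / 2)

@[fun_prop]
theorem continuous_centered : Continuous (centered : (N → I) → N → ℝ) := by
  unfold centered
  fun_prop

@[fun_prop]
theorem continuous_clampToCube : Continuous (clampToCube : (N → ℝ) → N → I) :=
  continuous_pi fun _ => continuous_projIcc.comp (by fun_prop)

theorem clampToCube_centered (p : N → I) : clampToCube (centered p) = p := by
  funext i
  have h : (1 + centered p i) / 2 = p i := by unfold centered; ring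
  rw [clampToCube, h, projIcc_val]

variable [Fintype N]

theorem norm_centered_le_one (p : N → I) : ‖centered p‖ ≤ 1 :=
  (pi_norm_le_iff_of_nonneg zero_le_one).2 fun i => by
    rw [Real.norm_eq_abs, abs_le, centered]
    constructor <;> linarith [(p i).2.1, (p i).2.2]

theorem norm_centered_of_mem_boundary {p : N → I} (hp : p ∈ Cube.boundary N) :
    ‖centered p‖ = 1 := by
  obtain ⟨i, hi⟩ := hp
  refine le_antisymm (norm_centered_le_one p) (le_trans ?_ (norm_le_pi_norm (centered p) i))
  rcases hi with hi | hi <;> norm_num [centered, hi]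

theorem clampToCube_mem_boundary {v : N → ℝ} (hv : ‖v‖ = 1) :
    clampToCube v ∈ Cube.boundary N := by
  obtain ⟨i, hi⟩ : ∃ i, 1 ≤ |v i| := by
    by_contra! h
    exact hv.not_lt ((pi_norm_lt_iff one_pos).2 h)
  refine ⟨i, (le_abs.1 hi).symm.imp (fun h => projIcc_of_le_left _ ?_)
    fun h => projIcc_of_right_le _ ?_⟩ <;> linarith

theorem exists_extension_of_cube (f : C(N → I, X)) (δ : C(I, X))
    (h : ∀ p ∈ Cube.boundary N, f p = δ 0) :
    ∃ G : C(N → ℝ, X), (∀ p, G (centered p) = f p) ∧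
      ∀ (v : N → ℝ) (t : I), ‖v‖ = 1 + t → G v = δ t := by
  classical
  let collar (v : N → ℝ) : X := δ (projIcc 0 1 zero_le_one (‖v‖ - 1))
  have collar_eq {v : N → ℝ} {t : I} (hv : ‖v‖ = 1 + t) : collar v = δ t := by
    simp only [collar, hv, add_sub_cancel_left, projIcc_val]
  have agree {v : N → ℝ} (hv : ‖v‖ = 1) : f (clampToCube v) = collar v := by
    rw [h _ (clampToCube_mem_boundary hv), collar_eq (t := 0) (by simpa using hv)]
  refine ⟨⟨fun v => if ‖v‖ ≤ 1 then f (clampToCube v) else collar v,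
    Continuous.if_le (by fun_prop) (δ.continuous.comp (continuous_projIcc.comp (by fun_prop)))
      continuous_norm continuous_const fun _ => agree⟩, fun p => ?_, fun v t hv => ?_⟩
  · exact (if_pos (norm_centered_le_one p)).trans (congrArg f (clampToCube_centered p))
  · rw [ContinuousMap.coe_mk, ← collar_eq hv]
    split_ifs with h1
    · exact agree (le_antisymm h1 (by linarith [t.2.1]))
    · rfl

omit [Fintype N] in
theorem exists_homotopy_extension [Finite N] (f : C(N → I, X)) (δ : C(I, X))
    (h : ∀ p ∈ Cube.boundary N, f p = δ 0) :
    ∃ F : C(I × (N → I), X), (∀ p, F (0, p) = f p) ∧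
      ∀ t, ∀ p ∈ Cube.boundary N, F (t, p) = δ t := by
  cases nonempty_fintype N
  obtain ⟨G, hGf, hGδ⟩ := exists_extension_of_cube f δ h
  refine ⟨⟨fun q => G ((1 + (q.1 : ℝ)) • centered q.2), by fun_prop⟩, fun p => ?_,
    fun t p hp => hGδ _ t ?_⟩
  · simpa using hGf p
  · rw [norm_smul, norm_centered_of_mem_boundary hp, mul_one, Real.norm_eq_abs,
      abs_of_nonneg (by linarith [t.2.1])]

end CubeExtension

section FreeHomotopy

variable {k : ℕ} {X Y : Type*} [TopologicalSpace X] [TopologicalSpace Y]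

/-- A free homotopy from the loop `f` to the loop `g`, which carries the boundary of the cube
along the path `γ` between the two base points. -/
def TrackHomotopic {x y : X} (γ : Path x y) (f : GenLoop (Fin k) X x)
    (g : GenLoop (Fin k) X y) : Prop :=
  ∃ H : f.1.Homotopy g.1, ∀ s, ∀ p ∈ Cube.boundary (Fin k), H (s, p) = γ s

/-- Free homotopy of loops, through maps which are constant on the boundary of the cube; the base
points need not agree. -/
def FreelyHomotopic {x y : X} (f : GenLoop (Fin k) X x) (g : GenLoop (Fin k) X y) : Prop :=
  ∃ γ : Path x y, TrackHomotopic γ f g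

namespace TrackHomotopic

variable {x y z : X} {γ : Path x y} {δ : Path y z} {f : GenLoop (Fin k) X x}
  {g : GenLoop (Fin k) X y} {l : GenLoop (Fin k) X z}

theorem symm : TrackHomotopic γ f g → TrackHomotopic γ.symm g f :=
  fun ⟨H, hH⟩ => ⟨H.symm, fun s p hp => hH (σ s) p hp⟩

theorem trans : TrackHomotopic γ f g → TrackHomotopic δ g l →
    TrackHomotopic (γ.trans δ) f l := by
  rintro ⟨H, hH⟩ ⟨K, hK⟩
  refine ⟨H.trans K, fun s p hp => ?_⟩
  rw [ContinuousMap.Homotopy.trans_apply, Path.trans_apply]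
  split_ifs
  · exact hH _ p hp
  · exact hK _ p hp

theorem of_homotopic {f' : GenLoop (Fin k) X x} (h : GenLoop.Homotopic f f') :
    TrackHomotopic (Path.refl x) f f' :=
  h.elim fun H => ⟨H.toHomotopy, fun s p hp => (H.prop s p hp).trans (f.2 p hp)⟩

theorem map (φ : C(X, Y)) {x' y' : Y} (hx : φ x = x') (hy : φ y = y') :
    TrackHomotopic γ f g → TrackHomotopic ((γ.map φ.continuous).cast hx.symm hy.symm)
      (mapLoop φ hx f) (mapLoop φ hy g) :=
  fun ⟨H, hH⟩ => ⟨(ContinuousMap.Homotopy.refl φ).comp H, fun s p hp => congrArg φ (hH s p hp)⟩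

theorem const (γ : Path x y) :
    TrackHomotopic γ (GenLoop.const : GenLoop (Fin k) X x) (GenLoop.const : GenLoop (Fin k) X y) :=
  ⟨⟨⟨fun q => γ q.1, by fun_prop⟩, fun _ => γ.source, fun _ => γ.target⟩, fun _ _ _ => rfl⟩

theorem exists_right (γ : Path x y) (f : GenLoop (Fin k) X x) :
    ∃ g : GenLoop (Fin k) X y, TrackHomotopic γ f g := by
  obtain ⟨F, hFf, hFγ⟩ := exists_homotopy_extension f.1 γ.toContinuousMap
    fun p hp => (f.2 p hp).trans γ.source.symm
  exact ⟨⟨⟨fun p => F (1, p), by fun_prop⟩, fun p hp => (hFγ 1 p hp).trans γ.target⟩,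
    ⟨F, hFf, fun _ => rfl⟩, hFγ⟩

/-- Shrinking the track to a point by a homotopy of paths extends, by the homotopy extension
property, to a homotopy of homotopies `E`. The three faces of its parameter square other than the
given homotopy compose to a homotopy relative to the boundary. -/
theorem homotopic {γ : Path x x} {f g : GenLoop (Fin k) X x} (h : TrackHomotopic γ f g)
    (hγ : γ.Homotopic (Path.refl x)) : GenLoop.Homotopic f g := by
  obtain ⟨H, hH⟩ := h
  obtain ⟨K⟩ := hγ
  obtain ⟨F, hF0, hFb⟩ := exists_homotopy_extension
    (H.toContinuousMap.comp ContinuousMap.prodSwap).curry K.toContinuousMap.curry fun p hp => by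
      ext s
      exact (hH s p hp).trans (K.apply_zero s).symm
  let E : C((I × (Fin k → I)) × I, X) := F.uncurry
  have hE0 (p s) : E ((0, p), s) = H (s, p) := DFunLike.congr_fun (hF0 p) s
  have hEb {t s} {p} (hp : p ∈ Cube.boundary (Fin k)) : E ((t, p), s) = K (t, s) :=
    DFunLike.congr_fun (hFb t p hp) s
  let slice (s : I) (hs : ∀ t, K (t, s) = x) : GenLoop (Fin k) X x :=
    ⟨⟨fun p => E ((1, p), s), by fun_prop⟩, fun p hp => (hEb hp).trans (hs 1)⟩
  have homotopic_slice (s : I) (hs : ∀ t, K (t, s) = x) (l : GenLoop (Fin k) X x)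
      (hl : ∀ p, H (s, p) = l p) : GenLoop.Homotopic l (slice s hs) :=
    ⟨⟨⟨⟨fun q => E ((q.1, q.2), s), by fun_prop⟩, fun p => (hE0 p s).trans (hl p), fun _ => rfl⟩,
      fun t p hp => ((hEb hp).trans (hs t)).trans (l.2 p hp).symm⟩⟩
  have slices : GenLoop.Homotopic (slice 0 K.source) (slice 1 K.target) :=
    ⟨⟨⟨⟨fun q => E ((1, q.2), q.1), by fun_prop⟩, fun _ => rfl, fun _ => rfl⟩,
      fun t p hp => ((hEb hp).trans (K.apply_one t)).trans ((hEb hp).trans (K.source 1)).symm⟩⟩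
  exact ((homotopic_slice 0 K.source f H.apply_zero).trans slices).trans
    (homotopic_slice 1 K.target g H.apply_one).symm

end TrackHomotopic

namespace FreelyHomotopic

variable {x y z : X} {f : GenLoop (Fin k) X x} {g : GenLoop (Fin k) X y} {l : GenLoop (Fin k) X z}

theorem symm : FreelyHomotopic f g → FreelyHomotopic g f := fun ⟨γ, h⟩ => ⟨γ.symm, h.symm⟩

theorem trans : FreelyHomotopic f g → FreelyHomotopic g l → FreelyHomotopic f l :=
  fun ⟨γ, h⟩ ⟨δ, h'⟩ => ⟨γ.trans δ, h.trans h'⟩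

theorem of_homotopic {f' : GenLoop (Fin k) X x} (h : GenLoop.Homotopic f f') :
    FreelyHomotopic f f' :=
  ⟨_, .of_homotopic h⟩

theorem refl (f : GenLoop (Fin k) X x) : FreelyHomotopic f f := of_homotopic (.refl f)

theorem map (φ : C(X, Y)) {x' y' : Y} (hx : φ x = x') (hy : φ y = y') :
    FreelyHomotopic f g → FreelyHomotopic (mapLoop φ hx f) (mapLoop φ hy g) :=
  fun ⟨_, h⟩ => ⟨_, h.map φ hx hy⟩

theorem homotopic_const (h : FreelyHomotopic f (GenLoop.const : GenLoop (Fin k) X y)) :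
    GenLoop.Homotopic f GenLoop.const := by
  obtain ⟨γ, h⟩ := h
  exact (h.trans (TrackHomotopic.const γ).symm).homotopic
    ⟨(Path.Homotopy.reflTransSymm γ).symm⟩

end FreelyHomotopic

/-- The path traced by a loop on the one-dimensional cube. -/
def loopPath {x : X} (f : GenLoop (Fin 1) X x) : Path x x where
  toFun t := f fun _ => t
  continuous_toFun := f.1.continuous.comp (by fun_prop)
  source' := f.2 _ ⟨0, Or.inl rfl⟩
  target' := f.2 _ ⟨0, Or.inr rfl⟩

theorem TrackHomotopic.loopPath_trans {x y : X} {γ : Path x y} {f : GenLoop (Fin 1) X x}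
    {g : GenLoop (Fin 1) X y} (h : TrackHomotopic γ f g) :
    ((loopPath f).trans γ).Homotopic (γ.trans (loopPath g)) := by
  obtain ⟨H, hH⟩ := h
  let F : ContinuousMap.Homotopy (loopPath f).toContinuousMap (loopPath g).toContinuousMap :=
    ⟨⟨fun q => H (q.1, fun _ => q.2), by fun_prop⟩, fun _ => H.apply_zero _,
      fun _ => H.apply_one _⟩
  have track0 : (F.evalAt 0).cast (loopPath f).source.symm (loopPath g).source.symm = γ :=
    Path.ext (funext fun s => hH s _ ⟨0, Or.inl rfl⟩)
  have track1 : (F.evalAt 1).cast (loopPath f).target.symm (loopPath g).target.symm = γ :=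
    Path.ext (funext fun s => hH s _ ⟨0, Or.inr rfl⟩)
  have square := (Path.Homotopic.map_trans_evalAt F Path.id).pathCast
    (loopPath f).source.symm (loopPath g).target.symm
  rwa [Path.cast_trans _ _ _ (loopPath f).target.symm,
    Path.cast_trans _ _ _ (loopPath g).source.symm, track0, track1] at square

theorem homotopic_of_loopPath {x : X} {f g : GenLoop (Fin 1) X x}
    (h : (loopPath f).Homotopic (loopPath g)) : GenLoop.Homotopic f g := by
  obtain ⟨K⟩ := h
  have diag (p : Fin 1 → I) : (fun _ => p 0) = p :=
    funext fun i => congrArg p (Subsingleton.elim 0 i)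
  refine ⟨⟨⟨⟨fun q => K (q.1, q.2 0), by fun_prop⟩, fun p => ?_, fun p => ?_⟩, ?_⟩⟩
  · exact (K.apply_zero (p 0)).trans (congrArg f (diag p))
  · exact (K.apply_one (p 0)).trans (congrArg g (diag p))
  · rintro t p ⟨i, hi⟩
    rw [Subsingleton.elim i 0] at hi
    refine Eq.trans ?_ (f.2 p ⟨0, hi⟩).symm
    change K (t, p 0) = x
    rcases hi with hi | hi
    · rw [hi, K.source]
    · rw [hi, K.target]

theorem homotopic_const_of_retract {E : Type*} [TopologicalSpace E] [AddCommGroup E] [Module ℝ E]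
    [ContinuousAdd E] [ContinuousSMul ℝ E] (i : C(X, E)) (r : C(E, X)) (h : ∀ x, r (i x) = x)
    {x : X} (f : GenLoop (Fin k) X x) : GenLoop.Homotopic f GenLoop.const := by
  have hf : Continuous f := f.1.continuous
  refine ⟨⟨⟨⟨fun q => r ((1 - (q.1 : ℝ)) • i (f q.2) + (q.1 : ℝ) • i x), by fun_prop⟩,
    fun p => ?_, fun p => ?_⟩, fun t p hp => ?_⟩⟩
  · simp [h]
  · simp [h]
  · change r ((1 - (t : ℝ)) • i (f p) + (t : ℝ) • i x) = f p
    rw [GenLoop.boundary f p hp, ← add_smul, sub_add_cancel, one_smul, h]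

end FreeHomotopy

/-! ### The Poincaré lemma for cubical chains -/

section Poincare

variable {M M' : Type*} [AddCommGroup M] [AddCommGroup M']

/-- The antiderivative of `φ` for forward differences which vanishes at `0`. -/
noncomputable def antideriv (φ : ℤ → M) (n : ℤ) : M :=
  ∑ j ∈ Finset.Ico 0 n, φ j - ∑ j ∈ Finset.Ico n 0, φ j

theorem antideriv_zero (φ : ℤ → M) : antideriv φ 0 = 0 := by simp [antideriv]

theorem antideriv_add_one (φ : ℤ → M) (n : ℤ) : antideriv φ (n + 1) = antideriv φ n + φ n := by
  unfold antideriv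
  rcases le_or_gt 0 n with h | h
  · rw [← Finset.insert_Ico_right_eq_Ico_add_one h, Finset.sum_insert (by simp),
      Finset.Ico_eq_empty (by omega : ¬ n < 0), Finset.Ico_eq_empty (by omega : ¬ n + 1 < 0)]
    abel
  · rw [← Finset.insert_Ico_add_one_left_eq_Ico h, Finset.sum_insert (by simp),
      Finset.Ico_eq_empty (by omega : ¬ (0 : ℤ) < n),
      Finset.Ico_eq_empty (by omega : ¬ (0 : ℤ) < n + 1)]
    abel

theorem map_antideriv (f : M →+ M') (φ : ℤ → M) (n : ℤ) :
    f (antideriv φ n) = antideriv (f ∘ φ) n := by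
  simp [antideriv, map_sum]

theorem antideriv_mem {N : AddSubgroup M} {φ : ℤ → M} (h : ∀ j, φ j ∈ N) (n : ℤ) :
    antideriv φ n ∈ N :=
  N.sub_mem (sum_mem fun j _ => h j) (sum_mem fun j _ => h j)

theorem antideriv_sum {ι : Type*} (s : Finset ι) (φ : ι → ℤ → M) (n : ℤ) :
    antideriv (fun j => ∑ i ∈ s, φ i j) n = ∑ i ∈ s, antideriv (φ i) n := by
  simp only [antideriv, Finset.sum_sub_distrib, Finset.sum_comm (s := s)]

theorem antideriv_add (φ ψ : ℤ → M) (n : ℤ) :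
    antideriv (fun j => φ j + ψ j) n = antideriv φ n + antideriv ψ n := by
  simp only [antideriv, Finset.sum_add_distrib]; abel

theorem antideriv_sub (φ ψ : ℤ → M) (n : ℤ) :
    antideriv (fun j => φ j - ψ j) n = antideriv φ n - antideriv ψ n := by
  simp only [antideriv, Finset.sum_sub_distrib]; abel

theorem antideriv_zsmul (m : ℤ) (φ : ℤ → M) (n : ℤ) :
    antideriv (fun j => m • φ j) n = m • antideriv φ n := by
  simp only [antideriv, ← Finset.smul_sum, ← smul_sub]

theorem antideriv_diff (φ : ℤ → M) (n : ℤ) :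
    antideriv (fun j => φ (j + 1) - φ j) n = φ n - φ 0 := by
  induction n with
  | zero => simp [antideriv_zero]
  | succ n ih => rw [antideriv_add_one, ih]; abel
  | pred n ih =>
    have h := antideriv_add_one (fun j => φ (j + 1) - φ j) (-(n : ℤ) - 1)
    rw [sub_add_cancel, ih] at h
    rw [← sub_eq_of_eq_add h]; abel

variable {D : ℕ}

/-- The sign with which the facets of a face with directions `T` in the direction `i` occur in its
boundary. -/
def dirSign (T : Finset (Fin D)) (i : Fin D) : ℤ := (-1) ^ (T.filter (· < i)).card

theorem dirSign_mul_self (T : Finset (Fin D)) (i : Fin D) : dirSign T i * dirSign T i = 1 := by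
  rw [dirSign, ← mul_pow, neg_mul_neg, one_mul, one_pow]

theorem dirSign_erase_self (T : Finset (Fin D)) (i : Fin D) :
    dirSign (T.erase i) i = dirSign T i := by
  rw [dirSign, Finset.filter_erase, Finset.erase_eq_of_notMem (by simp), dirSign]

theorem dirSign_insert_self (T : Finset (Fin D)) (i : Fin D) :
    dirSign (insert i T) i = dirSign T i := by
  rw [dirSign, Finset.filter_insert, if_neg (lt_irrefl i), dirSign]

theorem dirSign_insert_of_lt {T : Finset (Fin D)} {i j : Fin D} (hi : i ∉ T) (h : i < j) :
    dirSign (insert i T) j = - dirSign T j := by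
  rw [dirSign, Finset.filter_insert, if_pos h, Finset.card_insert_of_notMem (by simp [hi]),
    pow_succ, mul_neg_one, dirSign]

theorem dirSign_insert_of_not_lt {T : Finset (Fin D)} {i j : Fin D} (h : ¬ i < j) :
    dirSign (insert i T) j = dirSign T j := by
  rw [dirSign, Finset.filter_insert, if_neg h, dirSign]

theorem dirSign_mul_dirSign_erase {T : Finset (Fin D)} {i j : Fin D} (hi : i ∉ T) (hj : j ∈ T) :
    dirSign T j * dirSign (T.erase j) i = - (dirSign T i * dirSign (insert i T) j) := by
  have hT : dirSign T i = dirSign (insert j (T.erase j)) i := by rw [Finset.insert_erase hj]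
  rcases lt_or_gt_of_ne (ne_of_mem_of_not_mem hj hi).symm with h | h
  · rw [hT, dirSign_insert_of_lt hi h, dirSign_insert_of_not_lt h.asymm]; ring
  · rw [hT, dirSign_insert_of_not_lt h.asymm, dirSign_insert_of_lt (by simp) h]; ring

namespace Face

/-- The translate along the `i`-th axis whose base point has `i`-th coordinate `n`. -/
def moveTo (i : Fin D) (n : ℤ) (F : Face D) : Face D := ⟨Function.update F.base i n, F.dirs⟩

/-- The product of `[n, n + 1]` with the projection of a face along the `i`-th axis. -/
def thickenAt (i : Fin D) (n : ℤ) (F : Face D) : Face D :=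
  ⟨Function.update F.base i n, insert i F.dirs⟩

variable {i j : Fin D} {F : Face D}

theorem moveTo_base (i : Fin D) (F : Face D) : F.moveTo i (F.base i) = F :=
  Face.ext (Function.update_eq_self _ _) rfl

theorem update_base_upper_self (i : Fin D) (n : ℤ) (F : Face D) :
    Function.update (F.upper i).base i n = Function.update F.base i n := by
  unfold upper
  split_ifs <;> ext l <;> by_cases h : l = i <;> simp [h]

theorem update_base_upper (hij : i ≠ j) (n : ℤ) (F : Face D) :
    Function.update (F.upper j).base i n =
      if j ∈ F.dirs then Function.update F.base i n + unitVec j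
      else Function.update F.base i n := by
  unfold upper
  split_ifs
  · ext l
    by_cases h : l = i
    · subst h; simp [hij]
    · simp [h]
  · rfl

theorem base_upper_self (hi : i ∈ F.dirs) : (F.upper i).base i = F.base i + 1 := by
  simp [upper, hi]

theorem base_upper_of_ne (hij : i ≠ j) (F : Face D) : (F.upper j).base i = F.base i := by
  unfold upper
  split_ifs <;> simp [hij]

theorem upper_moveTo_self (i : Fin D) (n : ℤ) (F : Face D) :
    (F.upper i).moveTo i n = (F.lower i).moveTo i n :=
  Face.ext (update_base_upper_self i n F) rfl

theorem upper_moveTo (hij : i ≠ j) (n : ℤ) (F : Face D) :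
    (F.upper j).moveTo i n = (F.moveTo i n).upper j :=
  Face.ext (update_base_upper hij n F) rfl

theorem upper_thickenAt_self (hi : i ∈ F.dirs) (n : ℤ) : (F.upper i).thickenAt i n = F.moveTo i n :=
  Face.ext (update_base_upper_self i n F) (Finset.insert_erase hi)

theorem lower_thickenAt_self (hi : i ∈ F.dirs) (n : ℤ) : (F.lower i).thickenAt i n = F.moveTo i n :=
  Face.ext rfl (Finset.insert_erase hi)

theorem thickenAt_upper_self (hi : i ∉ F.dirs) (n : ℤ) :
    (F.thickenAt i n).upper i = F.moveTo i (n + 1) := by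
  refine Face.ext ?_ (Finset.erase_insert hi)
  simp only [upper, thickenAt, moveTo, Finset.mem_insert_self, if_true]
  ext l
  by_cases h : l = i
  · subst h; simp
  · simp [h]

theorem thickenAt_lower_self (hi : i ∉ F.dirs) (n : ℤ) :
    (F.thickenAt i n).lower i = F.moveTo i n :=
  Face.ext rfl (Finset.erase_insert hi)

theorem thickenAt_upper (hij : i ≠ j) (n : ℤ) (F : Face D) :
    (F.thickenAt i n).upper j = (F.upper j).thickenAt i n := by
  refine Face.ext ?_ (Finset.erase_insert_of_ne hij)
  simp only [thickenAt, upper, Finset.mem_insert, hij.symm, false_or]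
  exact (update_base_upper hij n F).symm

theorem thickenAt_lower (hij : i ≠ j) (n : ℤ) (F : Face D) :
    (F.thickenAt i n).lower j = (F.lower j).thickenAt i n :=
  Face.ext rfl (Finset.erase_insert_of_ne hij)

end Face

/-- The canonical cubical structure of `ℝ^D`. -/
abbrev euclideanComplex (D : ℕ) : CubicalComplex D where
  Cell := Face D
  face F := F
  lower := Face.lower
  upper := Face.upper
  face_lower _ _ := rfl
  face_upper _ _ := rfl

local notation "δ" => CubicalComplex.coboundary (euclideanComplex _) _

/-- The pullback of cochains along the projection of `ℝ^D` to the hyperplane where the `i`-th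
coordinate vanishes. -/
def axisProj (i : Fin D) (η : Face D → M) (F : Face D) : M :=
  if i ∈ F.dirs then 0 else η (F.moveTo i 0)

/-- The cochain homotopy from `axisProj i` to the identity given by integration along the `i`-th
axis. -/
noncomputable def axisHomotopy (i : Fin D) (η : Face D → M) (F : Face D) : M :=
  if i ∈ F.dirs then 0 else
    dirSign F.dirs i • antideriv (fun n => η (F.thickenAt i n)) (F.base i)

theorem coboundary_apply (η : Face D → M) (F : Face D) :
    δ η F = ∑ j ∈ F.dirs, dirSign F.dirs j • (η (F.upper j) - η (F.lower j)) := rfl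

section Axis

variable {i j : Fin D} {F : Face D} (η : Face D → M)

theorem axisProj_of_mem (hi : i ∈ F.dirs) : axisProj i η F = 0 := if_pos hi

theorem axisProj_of_notMem (hi : i ∉ F.dirs) : axisProj i η F = η (F.moveTo i 0) := if_neg hi

theorem axisHomotopy_of_mem (hi : i ∈ F.dirs) : axisHomotopy i η F = 0 := if_pos hi

theorem axisHomotopy_of_notMem (hi : i ∉ F.dirs) :
    axisHomotopy i η F = dirSign F.dirs i • antideriv (fun n => η (F.thickenAt i n)) (F.base i) :=
  if_neg hi

theorem axisHomotopy_upper_self :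
    axisHomotopy i η (F.upper i) = dirSign F.dirs i •
      antideriv (fun n => η ((F.upper i).thickenAt i n)) ((F.upper i).base i) := by
  rw [axisHomotopy_of_notMem η (Finset.notMem_erase i _), ← dirSign_erase_self F.dirs i]; rfl

theorem axisHomotopy_lower_self :
    axisHomotopy i η (F.lower i) = dirSign F.dirs i •
      antideriv (fun n => η ((F.lower i).thickenAt i n)) (F.base i) := by
  rw [axisHomotopy_of_notMem η (Finset.notMem_erase i _), ← dirSign_erase_self F.dirs i]; rfl

theorem coboundary_axisProj (i : Fin D) : δ (axisProj i η) = axisProj i (δ η) := by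
  funext F
  by_cases hi : i ∈ F.dirs
  · rw [coboundary_apply, axisProj_of_mem _ hi]
    refine Finset.sum_eq_zero fun j _ => ?_
    rcases eq_or_ne i j with rfl | hij
    · rw [axisProj_of_notMem η (Finset.notMem_erase i _),
        axisProj_of_notMem η (Finset.notMem_erase i _), Face.upper_moveTo_self, sub_self, smul_zero]
    · have hi' : i ∈ F.dirs.erase j := Finset.mem_erase.2 ⟨hij, hi⟩
      rw [axisProj_of_mem η hi', axisProj_of_mem η hi', sub_self, smul_zero]
  · rw [axisProj_of_notMem _ hi, coboundary_apply, coboundary_apply]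
    refine Finset.sum_congr rfl fun j hj => ?_
    have hi' : i ∉ F.dirs.erase j := fun h => hi (Finset.mem_of_mem_erase h)
    rw [axisProj_of_notMem η hi', axisProj_of_notMem η hi',
      Face.upper_moveTo (ne_of_mem_of_not_mem hj hi).symm]
    rfl

theorem coboundary_axisHomotopy_of_mem (hi : i ∈ F.dirs) : δ (axisHomotopy i η) F = η F := by
  rw [coboundary_apply, Finset.sum_eq_single_of_mem i hi]
  · rw [axisHomotopy_upper_self, axisHomotopy_lower_self, Face.base_upper_self hi]
    simp only [Face.upper_thickenAt_self hi, Face.lower_thickenAt_self hi]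
    rw [antideriv_add_one, ← smul_sub, add_sub_cancel_left, smul_smul, dirSign_mul_self, one_smul,
      Face.moveTo_base]
  · intro j _ hij
    have hi' : i ∈ F.dirs.erase j := Finset.mem_erase.2 ⟨hij.symm, hi⟩
    rw [axisHomotopy_of_mem η hi', axisHomotopy_of_mem η hi', sub_self, smul_zero]

theorem coboundary_thickenAt (hi : i ∉ F.dirs) (n : ℤ) :
    δ η (F.thickenAt i n) = dirSign F.dirs i • (η (F.moveTo i (n + 1)) - η (F.moveTo i n)) +
      ∑ j ∈ F.dirs, dirSign (insert i F.dirs) j •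
        (η ((F.upper j).thickenAt i n) - η ((F.lower j).thickenAt i n)) := by
  rw [coboundary_apply]
  change ∑ j ∈ insert i F.dirs, dirSign (insert i F.dirs) j • _ = _
  rw [Finset.sum_insert hi, dirSign_insert_self, Face.thickenAt_upper_self hi,
    Face.thickenAt_lower_self hi]
  congr 1
  refine Finset.sum_congr rfl fun j hj => ?_
  have hij : i ≠ j := (ne_of_mem_of_not_mem hj hi).symm
  rw [Face.thickenAt_upper hij, Face.thickenAt_lower hij]

theorem axisHomotopy_coboundary_of_notMem (hi : i ∉ F.dirs) :
    axisHomotopy i (δ η) F = η F - η (F.moveTo i 0) - δ (axisHomotopy i η) F := by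
  have facet_term {j : Fin D} (hj : j ∈ F.dirs) :
      dirSign F.dirs j • (axisHomotopy i η (F.upper j) - axisHomotopy i η (F.lower j)) =
        -(dirSign F.dirs i • dirSign (insert i F.dirs) j •
          (antideriv (fun n => η ((F.upper j).thickenAt i n)) (F.base i) -
            antideriv (fun n => η ((F.lower j).thickenAt i n)) (F.base i))) := by
    have hi' : i ∉ F.dirs.erase j := fun h => hi (Finset.mem_of_mem_erase h)
    rw [axisHomotopy_of_notMem η hi', axisHomotopy_of_notMem η hi',
      Face.base_upper_of_ne (ne_of_mem_of_not_mem hj hi).symm]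
    change _ • (dirSign (F.dirs.erase j) i • _ - dirSign (F.dirs.erase j) i •
      antideriv _ (F.base i)) = _
    rw [← smul_sub, smul_smul, dirSign_mul_dirSign_erase hi hj, neg_smul, mul_smul]
  rw [axisHomotopy_of_notMem _ hi, coboundary_apply (axisHomotopy i η),
    Finset.sum_congr rfl fun j hj => facet_term hj, Finset.sum_neg_distrib, sub_neg_eq_add,
    ← Finset.smul_sum]
  simp only [coboundary_thickenAt η hi]
  rw [antideriv_add, antideriv_zsmul, antideriv_diff (fun n => η (F.moveTo i n)), antideriv_sum]
  simp only [antideriv_zsmul, antideriv_sub]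
  rw [smul_add, smul_smul, dirSign_mul_self, one_smul, F.moveTo_base]

theorem coboundary_axisHomotopy_add (i : Fin D) :
    δ (axisHomotopy i η) + axisHomotopy i (δ η) = η - axisProj i η := by
  funext F
  rw [Pi.add_apply, Pi.sub_apply]
  by_cases hi : i ∈ F.dirs
  · rw [coboundary_axisHomotopy_of_mem η hi, axisHomotopy_of_mem _ hi, axisProj_of_mem η hi,
      add_zero, sub_zero]
  · rw [axisHomotopy_coboundary_of_notMem η hi, axisProj_of_notMem η hi, add_sub_cancel]

end Axis

/-- The pullback of cochains along the projection of `ℝ^D` to the subspace where the coordinates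
listed in `l` vanish. -/
def axesProj : List (Fin D) → (Face D → M) → Face D → M
  | [], η => η
  | i :: l, η => axisProj i (axesProj l η)

/-- The cochain homotopy from `axesProj l` to the identity obtained by integrating along one axis
after the other. -/
noncomputable def axesHomotopy : List (Fin D) → (Face D → M) → Face D → M
  | [], _ => 0
  | i :: l, η => axesHomotopy l η + axisHomotopy i (axesProj l η)

theorem coboundary_axesProj (l : List (Fin D)) (η : Face D → M) :
    δ (axesProj l η) = axesProj l (δ η) := by
  induction l with
  | nil => rfl
  | cons i l ih => rw [axesProj, coboundary_axisProj, ih, axesProj]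

theorem coboundary_axesHomotopy_add (l : List (Fin D)) (η : Face D → M) :
    δ (axesHomotopy l η) + axesHomotopy l (δ η) = η - axesProj l η := by
  induction l with
  | nil => simp [axesHomotopy, axesProj]
  | cons i l ih =>
    have h := coboundary_axisHomotopy_add (axesProj l η) i
    rw [coboundary_axesProj] at h
    rw [axesHomotopy, axesHomotopy, axesProj, map_add, add_add_add_comm, ih, h,
      sub_add_sub_cancel]

theorem map_coboundary (f : M →+ M') (η : Face D → M) : f ∘ δ η = δ (f ∘ η) := by
  refine funext fun F : Face D => ?_
  rw [Function.comp_apply, coboundary_apply, coboundary_apply, map_sum]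
  simp only [map_zsmul, map_sub, Function.comp_apply]

theorem map_axisProj (f : M →+ M') (i : Fin D) (η : Face D → M) :
    f ∘ axisProj i η = axisProj i (f ∘ η) := by
  funext F
  simp only [Function.comp_apply, axisProj, apply_ite f, map_zero]

theorem map_axisHomotopy (f : M →+ M') (i : Fin D) (η : Face D → M) :
    f ∘ axisHomotopy i η = axisHomotopy i (f ∘ η) := by
  funext F
  simp only [Function.comp_apply, axisHomotopy, apply_ite f, map_zero, map_zsmul, map_antideriv]
  rfl

theorem map_axesProj (f : M →+ M') (l : List (Fin D)) (η : Face D → M) :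
    f ∘ axesProj l η = axesProj l (f ∘ η) := by
  induction l with
  | nil => rfl
  | cons i l ih => rw [axesProj, map_axisProj, ih, axesProj]

theorem map_axesHomotopy (f : M →+ M') (l : List (Fin D)) (η : Face D → M) :
    f ∘ axesHomotopy l η = axesHomotopy l (f ∘ η) := by
  induction l with
  | nil => exact funext fun _ => map_zero f
  | cons i l ih =>
    rw [axesHomotopy, axesHomotopy, ← ih, ← map_axesProj, ← map_axisHomotopy]
    exact funext fun F => map_add f _ _

theorem axesHomotopy_zero (l : List (Fin D)) : axesHomotopy l (0 : Face D → M) = 0 :=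
  (map_axesHomotopy (0 : M →+ M) l 0).symm

section Degree

variable {N : AddSubgroup M} {η : Face D → M} {n : ℕ} {F : Face D}

theorem axisProj_mem (hη : ∀ E, E.dirs.card = n → η E ∈ N) (i : Fin D) (hF : F.dirs.card = n) :
    axisProj i η F ∈ N := by
  rw [axisProj]
  split_ifs
  · exact N.zero_mem
  · exact hη _ hF

theorem axesProj_mem (hη : ∀ E, E.dirs.card = n → η E ∈ N) (l : List (Fin D))
    (hF : F.dirs.card = n) : axesProj l η F ∈ N := by
  induction l generalizing F with
  | nil => exact hη F hF
  | cons i l ih => exact axisProj_mem (fun E hE => ih hE) i hF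

theorem axisHomotopy_mem (hη : ∀ E, E.dirs.card = n + 1 → η E ∈ N) (i : Fin D)
    (hF : F.dirs.card = n) : axisHomotopy i η F ∈ N := by
  rw [axisHomotopy]
  split_ifs with hi
  · exact N.zero_mem
  · exact N.zsmul_mem (antideriv_mem
      (fun _ => hη _ ((Finset.card_insert_of_notMem hi).trans (congrArg (· + 1) hF))) _) _

theorem axesHomotopy_mem (hη : ∀ E, E.dirs.card = n + 1 → η E ∈ N) (l : List (Fin D))
    (hF : F.dirs.card = n) : axesHomotopy l η F ∈ N := by
  induction l with
  | nil => exact N.zero_mem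
  | cons i l ih => exact N.add_mem ih (axisHomotopy_mem (fun E hE => axesProj_mem hη l hE) i hF)

theorem axesProj_of_mem (η : Face D → M) {l : List (Fin D)} {i : Fin D} (hl : i ∈ l)
    (hi : i ∈ F.dirs) : axesProj l η F = 0 := by
  induction l generalizing F with
  | nil => cases hl
  | cons j l ih =>
    by_cases hj : j ∈ F.dirs
    · exact axisProj_of_mem _ hj
    · rw [axesProj, axisProj_of_notMem _ hj]
      exact ih ((List.mem_cons.1 hl).resolve_left (ne_of_mem_of_not_mem hi hj)) hi

end Degree

theorem axesProj_finRange_of_pos (η : Face D → M) {F : Face D} (hF : 0 < F.dirs.card) :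
    axesProj (List.finRange D) η F = 0 := by
  obtain ⟨i, hi⟩ := Finset.card_pos.1 hF
  exact axesProj_of_mem η (List.mem_finRange i) hi

variable {G : Type*} [AddCommGroup G]

theorem euclideanComplex_cocycles_le_coboundaries (D k : ℕ) :
    (euclideanComplex D).cocycles G (k + 1) ≤ (euclideanComplex D).coboundaries G (k + 1) := by
  rintro η ⟨hη, hδ : δ η = 0⟩
  have hproj : axesProj (List.finRange D) η = 0 := by
    funext F
    rcases Nat.eq_zero_or_pos F.dirs.card with h | h
    · exact axesProj_mem (N := ⊥) (fun E hE => hη E (by rw [CubicalComplex.dim, hE]; omega)) _ h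
    · exact axesProj_finRange_of_pos η h
  refine ⟨axesHomotopy (List.finRange D) η, fun F hF => ?_, ?_⟩
  · exact axesHomotopy_mem (N := ⊥)
      (fun E hE => hη E fun h => hF (Nat.succ_injective (hE.symm.trans h))) _ rfl
  · have h := coboundary_axesHomotopy_add (List.finRange D) η
    rwa [hδ, axesHomotopy_zero, add_zero, hproj, sub_zero] at h

/-- The operator on chains dual to an operator `T` on cochains: its values on the generators are
those of `T` on the universal cochain, which sends each cell to itself. -/
noncomputable def dualOp (T : (Face D → G →+ Face D →₀ G) → Face D → G →+ Face D →₀ G) :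
    (Face D →₀ G) →+ (Face D →₀ G) :=
  Finsupp.liftAddHom (T Finsupp.singleAddHom)

theorem dualOp_coboundary : dualOp (G := G) (δ) = (euclideanComplex D).boundary G := rfl

theorem dualOp_single (T : (Face D → G →+ Face D →₀ G) → Face D → G →+ Face D →₀ G)
    (F : Face D) (g : G) : dualOp T (Finsupp.single F g) = T Finsupp.singleAddHom F g :=
  Finsupp.liftAddHom_apply_single _ _ _

theorem compHom_dualOp_singleAddHom
    (T : (Face D → G →+ Face D →₀ G) → Face D → G →+ Face D →₀ G) :
    AddMonoidHom.compHom (dualOp T) ∘ Finsupp.singleAddHom = T Finsupp.singleAddHom :=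
  funext fun F => AddMonoidHom.ext fun g => dualOp_single T F g

theorem dualOp_mem {T : (Face D → G →+ Face D →₀ G) → Face D → G →+ Face D →₀ G}
    {N : AddSubgroup (Face D →₀ G)} {x : Face D →₀ G}
    (h : ∀ F, x F ≠ 0 → ∀ g, T Finsupp.singleAddHom F g ∈ N) : dualOp T x ∈ N :=
  sum_mem fun F hF => h F (Finsupp.mem_support_iff.1 hF) _

theorem boundary_dualOp_axesHomotopy_add (l : List (Fin D)) (x : Face D →₀ G) :
    (euclideanComplex D).boundary G (dualOp (axesHomotopy l) x) +
      dualOp (axesHomotopy l) ((euclideanComplex D).boundary G x) = x - dualOp (axesProj l) x := by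
  suffices h : ((euclideanComplex D).boundary G).comp (dualOp (axesHomotopy l)) +
      (dualOp (axesHomotopy l)).comp ((euclideanComplex D).boundary G) =
        AddMonoidHom.id _ - dualOp (axesProj l) from DFunLike.congr_fun h x
  refine Finsupp.addHom_ext fun F g => ?_
  have hd := congrFun (map_axesHomotopy (AddMonoidHom.compHom (dualOp (G := G) δ)) l
    Finsupp.singleAddHom) F
  have hh := congrFun (map_coboundary (AddMonoidHom.compHom (dualOp (G := G) (axesHomotopy l)))
    Finsupp.singleAddHom) F
  rw [compHom_dualOp_singleAddHom] at hd hh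
  have key := DFunLike.congr_fun
    (congrFun (coboundary_axesHomotopy_add l (Finsupp.singleAddHom (M := G))) F) g
  rw [Pi.add_apply, ← hd, ← hh, add_comm] at key
  simpa [← dualOp_coboundary, dualOp_single] using key

theorem dualOp_axesHomotopy_mem_chains {k : ℕ} {x : Face D →₀ G}
    (hx : x ∈ (euclideanComplex D).chains G k) (l : List (Fin D)) :
    dualOp (axesHomotopy l) x ∈ (euclideanComplex D).chains G (k + 1) := by
  refine dualOp_mem fun F hF g => ?_
  have hFk : F.dirs.card = k := by_contra fun h => hF (hx F h)
  rw [← AddMonoidHom.eval_apply_apply, ← Function.comp_apply (f := AddMonoidHom.eval g),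
    map_axesHomotopy]
  have single_mem (E : Face D) (hE : E.dirs.card = k + 1) :
      Finsupp.single E g ∈ (euclideanComplex D).chains G (k + 1) := fun E' hE' =>
    Finsupp.single_eq_of_ne fun h => hE' (h ▸ hE)
  exact axesHomotopy_mem single_mem l hFk

theorem euclideanComplex_cycles_le_boundaries (D k : ℕ) :
    (euclideanComplex D).cycles G (k + 1) ≤ (euclideanComplex D).boundaries G (k + 1) := by
  rintro x ⟨hx, hd : (euclideanComplex D).boundary G x = 0⟩
  have hproj : dualOp (axesProj (List.finRange D)) x = 0 := by
    refine dualOp_mem (N := ⊥) fun F hF g => ?_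
    have hFk : F.dirs.card = k + 1 := by_contra fun h => hF (hx F h)
    exact DFunLike.congr_fun (axesProj_finRange_of_pos _ (by omega)) g
  refine ⟨_, dualOp_axesHomotopy_mem_chains hx (List.finRange D), ?_⟩
  have h := boundary_dualOp_axesHomotopy_add (List.finRange D) x
  rwa [hd, map_zero, add_zero, hproj, sub_zero] at h

namespace CubicalComplex.Hom

variable {X Y : CubicalComplex D} {f : Hom X Y} {g : Hom Y X} {k : ℕ}

theorem cycles_le_boundaries (hgf : Function.LeftInverse g.toFun f.toFun)
    (h : Y.cycles G k ≤ Y.boundaries G k) : X.cycles G k ≤ X.boundaries G k := by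
  intro x hx
  have hx' : g.chainMap G (f.chainMap G x) = x := by
    change Finsupp.mapDomain g.toFun (Finsupp.mapDomain f.toFun x) = x
    rw [← Finsupp.mapDomain_comp, hgf.comp_eq_id, Finsupp.mapDomain_id]
  exact hx' ▸ g.chainMap_mem_boundaries G (h (f.chainMap_mem_cycles G hx))

theorem cocycles_le_coboundaries (hgf : Function.LeftInverse g.toFun f.toFun)
    (h : Y.cocycles G k ≤ Y.coboundaries G k) : X.cocycles G k ≤ X.coboundaries G k := by
  intro η hη
  have hη' : f.cochainMap G (g.cochainMap G η) = η := funext fun c => congrArg η (hgf c)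
  exact hη' ▸ f.cochainMap_mem_coboundaries G (h (g.cochainMap_mem_cocycles G hη))

end CubicalComplex.Hom

/-- The inclusion of a region into `ℝ^D`. -/
def regionToEuclidean (Y : Set (Lattice D)) :
    CubicalComplex.Hom (regionComplex Y) (euclideanComplex D) where
  toFun c := c.1
  face_eq _ := rfl
  map_lower _ _ _ := rfl
  map_upper _ _ _ := rfl

/-- The identification of `ℝ^D` with the region of all lattice points. -/
def euclideanToRegion (D : ℕ) :
    CubicalComplex.Hom (euclideanComplex D) (regionComplex univ) where
  toFun F := ⟨F, F.base, subset_univ _, fun _ => Or.inl rfl⟩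
  face_eq _ := rfl
  map_lower _ _ _ := rfl
  map_upper _ _ _ := rfl

theorem euclideanToRegion_leftInverse :
    Function.LeftInverse (euclideanToRegion D).toFun (regionToEuclidean univ).toFun := fun _ => rfl

variable {Y : Set (Lattice D)} {k : ℕ}

theorem regionComplex_homology_eq_zero (hY : Y = univ) (hk : 1 ≤ k)
    (x : (regionComplex Y).Homology G k) : x = 0 := by
  subst hY
  obtain ⟨k, rfl⟩ := Nat.exists_eq_add_of_le' hk
  induction x using QuotientAddGroup.induction_on with
  | H x =>
    exact (QuotientAddGroup.eq_zero_iff x).2 (CubicalComplex.Hom.cycles_le_boundaries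
      euclideanToRegion_leftInverse (euclideanComplex_cycles_le_boundaries D k) x.2)

theorem regionComplex_cohomology_eq_zero (hY : Y = univ) (hk : 1 ≤ k)
    (x : (regionComplex Y).Cohomology G k) : x = 0 := by
  subst hY
  obtain ⟨k, rfl⟩ := Nat.exists_eq_add_of_le' hk
  induction x using QuotientAddGroup.induction_on with
  | H x =>
    exact (QuotientAddGroup.eq_zero_iff x).2 (CubicalComplex.Hom.cocycles_le_coboundaries
      euclideanToRegion_leftInverse (euclideanComplex_cocycles_le_coboundaries D k) x.2)

end Poincare

/-! ### Homology and cohomology defects -/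

section Persistence

variable {D : ℕ} {A : Type*} {S : Set (Config D A)} {a : Config D A}

theorem mem_slightlyDefective_iff :
    a ∈ slightlyDefective S ↔ ∀ r, (unflawed S a r).Nonempty := by
  constructor
  · intro h r
    have hr : ((r + 1 : ℕ) : ℕ∞) < ⨆ z, defectField S a z := by
      rw [show ⨆ z, defectField S a z = ⊤ from h]
      exact ENat.natCast_lt_top _
    obtain ⟨z, hz⟩ := lt_iSup_iff.1 hr
    exact ⟨z, unflawed_anti S a r.le_succ ((le_defectField_iff S a z r.succ_pos).1 hz.le)⟩
  · intro h
    refine ENat.eq_top_iff_forall_ge.2 fun r => ?_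
    obtain ⟨z, hz⟩ := h (r + 1)
    calc (r : ℕ∞) ≤ (r + 1 : ℕ) := by exact_mod_cast r.le_succ
      _ ≤ defectField S a z := (le_defectField_iff S a z r.succ_pos).2 hz
      _ ≤ ⨆ z, defectField S a z := le_iSup _ z

theorem blockAt_shift (r : ℕ) (v z : Lattice D) :
    blockAt (shift v a) r z = blockAt a r (z + v) :=
  funext fun x => congrArg a (add_right_comm z x.1 v)

theorem mem_unflawed_of_mem (hinv : ∀ v, MapsTo (shift v) S S) (ha : a ∈ S) (r : ℕ)
    (z : Lattice D) : z ∈ unflawed S a r :=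
  ⟨shift z a, hinv z ha, (blockAt_shift r z 0).trans (by rw [zero_add])⟩

theorem unflawed_eq_univ (hinv : ∀ v, MapsTo (shift v) S S) (ha : a ∈ S) (r : ℕ) :
    unflawed S a r = univ :=
  eq_univ_of_forall (mem_unflawed_of_mem hinv ha r)

theorem isPersistent_of_invariant {P : Config D A → Prop} {Φ : Config D A → Config D A}
    (hdef : ∀ a, P a → IsDefective S a) (himage : ∀ a, P a → P (Φ a)) (ha : P a) :
    IsPersistent S Φ a := by
  intro t
  refine hdef _ ?_
  induction t with
  | zero => exact ha
  | succ t ih => rw [Function.iterate_succ_apply']; exact himage _ ih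

section Image

variable {Φ : Config D A → Config D A} {q : ℕ} (hq : HasRadius Φ q)

include hq in
theorem blockAt_image {c : Config D A} {r : ℕ} {z w : Lattice D}
    (h : blockAt a (r + q) z = blockAt c (r + q) w) : blockAt (Φ a) r z = blockAt (Φ c) r w := by
  refine funext fun x => hq _ _ _ _ fun y hy => ?_
  simpa only [blockAt, ← add_assoc] using congrFun h ⟨x + y, box_add x.2 hy⟩

variable (hS : MapsTo Φ S S)

include hq hS

variable (a) in
theorem unflawed_subset_image (r : ℕ) : unflawed S a (r + q) ⊆ unflawed S (Φ a) r :=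
  fun _ ⟨c, hc, h⟩ => ⟨Φ c, hS hc, blockAt_image hq h⟩

theorem image_mem_slightlyDefective (ha : a ∈ slightlyDefective S) :
    Φ a ∈ slightlyDefective S :=
  mem_slightlyDefective_iff.2 fun r =>
    (mem_slightlyDefective_iff.1 ha (r + q)).mono (unflawed_subset_image a hq hS r)

variable (a)

theorem caMap_tileAt (r : ℕ) {z : Lattice D} (hz : z ∈ unflawed S a (r + q)) :
    (caMap hq hS r).toFun ⟨blockAt a (r + q) z, hz⟩ =
      ⟨blockAt (Φ a) r z, unflawed_subset_image a hq hS r hz⟩ :=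
  Subtype.ext (blockAt_image hq hz.choose_spec.2)

theorem caMap_sectionHom (r : ℕ) (c : (regionComplex (unflawed S a (r + q))).Cell) :
    (caMap hq hS r).cellMap.toFun ((sectionHom S a (r + q)).toFun c) =
      (sectionHom S (Φ a) r).toFun ((regionIncl (unflawed_subset_image a hq hS r)).toFun c) := by
  let c' := (regionIncl (unflawed_subset_image a hq hS r)).toFun c
  have hc := cubesIn_mono (unflawed_subset_image a hq hS r) c.2.choose_spec.1
  calc (caMap hq hS r).cellMap.toFun ((sectionHom S a (r + q)).toFun c)
      = cellAt (Φ a) r c.1 c.2.choose (cubesIn_subset _ hc) c.2.choose_spec.2 := by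
        have e := caMap_tileAt a hq hS r (cubesIn_subset _ c.2.choose_spec.1)
        change Quot.mk _ (⟨((_, (caMap hq hS r).toFun ⟨blockAt a (r + q) c.2.choose, _⟩), c.1), _⟩ :
          {x : Tile S r × Face D // x.2.InCube x.1.1}) = _
        rw [e]
        rfl
    _ = (sectionHom S (Φ a) r).toFun c' :=
        cellAt_eq (Φ a) r c.1 hc c'.2.choose_spec.1 c.2.choose_spec.2 c'.2.choose_spec.2

theorem caMap_sectionMap (r : ℕ) (p : thicken (unflawed S a (r + q))) :
    (caMap hq hS r).spaceMap (sectionMap S a (r + q) p) =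
      sectionMap S (Φ a) r ⟨p.1, thicken_mono (unflawed_subset_image a hq hS r) p.2⟩ := by
  obtain ⟨z, hz, hp⟩ := p.2
  rw [sectionMap_apply a (r + q) p hz hp,
    sectionMap_apply (Φ a) r _ (cubesIn_mono (unflawed_subset_image a hq hS r) hz) hp]
  have e := caMap_tileAt a hq hS r (cubesIn_subset _ hz)
  change Quot.mk _ (⟨(z, (caMap hq hS r).toFun ⟨blockAt a (r + q) z, _⟩), ⟨p.1, hp⟩⟩ :
    Σ t : Tile S r, unitCube t.1) = _
  rw [e]
  rfl

end Image

variable {G : Type*} [AddCommGroup G] {k : ℕ}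

theorem HasHomologyDefect.isDefective (hinv : ∀ v, MapsTo (shift v) S S) (hk : 1 ≤ k)
    (h : HasHomologyDefect S G k a) : IsDefective S a := by
  refine ⟨h.1, fun ha => h.2 (AddMonoidHom.ext fun u => Subtype.ext (funext fun r => ?_))⟩
  change (sectionHom S a r).homologyMap G k (u.1 r) = 0
  rw [regionComplex_homology_eq_zero (unflawed_eq_univ hinv ha r) hk (u.1 r), map_zero]

theorem HasCohomologyDefect.isDefective (hinv : ∀ v, MapsTo (shift v) S S) (hk : 1 ≤ k)
    (h : HasCohomologyDefect S G k a) : IsDefective S a := by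
  refine ⟨h.1, fun ha => h.2 (AddCommGroup.DirectLimit.hom_ext _ fun r =>
    AddMonoidHom.ext fun x => ?_)⟩
  rw [cohomologySignature, AddMonoidHom.comp_apply, AddCommGroup.DirectLimit.map_apply_of,
    regionComplex_cohomology_eq_zero (unflawed_eq_univ hinv ha r) hk
      ((sectionHom S a r).cohomologyMap G k x), map_zero]
  rfl

variable {Φ : Config D A → Config D A} {q : ℕ} (hq : HasRadius Φ q) (hS : MapsTo Φ S S)

variable (a G k) in
/-- The map `H_k(G_∞(a), G) → H_k(G_∞(Φ(a)), G)` induced by the inclusions of `G_{r+q}(a)` into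
`G_r(Φ(a))`. -/
noncomputable def regionHomologyMap : RegionHomology S G k a →+ RegionHomology S G k (Φ a) where
  toFun u := ⟨fun r =>
      (regionIncl (unflawed_subset_image a hq hS r)).homologyMap G k (u.1 (r + q)),
    fun r s h => (CubicalComplex.Hom.homologyMap_square
        (regionIncl (unflawed_subset_image a hq hS s)) (regionIncl (unflawed_anti S (Φ a) h))
        (regionIncl (unflawed_anti S a (Nat.add_le_add_right h q)))
        (regionIncl (unflawed_subset_image a hq hS r)) (fun _ => rfl) _ _).trans
      (congrArg _ (u.2 _ _ (Nat.add_le_add_right h q)))⟩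
  map_zero' := Subtype.ext (funext fun _ => map_zero _)
  map_add' _ _ := Subtype.ext (funext fun _ => map_add _ _ _)

theorem projHomologyMap_homologySignature (u : RegionHomology S G k a) :
    projHomologyMap G k hq hS (homologySignature S G k a u) =
      homologySignature S G k (Φ a) (regionHomologyMap a G k hq hS u) :=
  Subtype.ext (funext fun r =>
    CubicalComplex.Hom.homologyMap_square _ _ _ _ (caMap_sectionHom a hq hS r) _ _)

theorem HasHomologyDefect.image (hinj : Function.Injective (projHomologyMap G k hq hS))
    (h : HasHomologyDefect S G k a) : HasHomologyDefect S G k (Φ a) := by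
  refine ⟨image_mem_slightlyDefective hq hS h.1, fun h0 => h.2 (AddMonoidHom.ext fun u => hinj ?_)⟩
  rw [projHomologyMap_homologySignature, h0, AddMonoidHom.zero_apply, AddMonoidHom.zero_apply,
    map_zero]

variable (a G k) in
/-- The map `H^k(G_∞(Φ(a)), G) → H^k(G_∞(a), G)` induced by the inclusions of `G_{r+q}(a)` into
`G_r(Φ(a))`. -/
noncomputable def regionCohomologyMap :
    RegionCohomology S G k (Φ a) →+ RegionCohomology S G k a :=
  AddCommGroup.DirectLimit.lift _ _ _
    (fun r => (AddCommGroup.DirectLimit.of _ _ (r + q)).comp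
      ((regionIncl (unflawed_subset_image a hq hS r)).cohomologyMap G k))
    fun r s h x => by
      simp only [AddMonoidHom.comp_apply]
      rw [CubicalComplex.Hom.cohomologyMap_square
        (regionIncl (unflawed_subset_image a hq hS s)) (regionIncl (unflawed_anti S (Φ a) h))
        (regionIncl (unflawed_anti S a (Nat.add_le_add_right h q)))
        (regionIncl (unflawed_subset_image a hq hS r)) (fun _ => rfl)]
      exact AddCommGroup.DirectLimit.of_f (Nat.add_le_add_right h q) _

theorem cohomologySignature_comp_projCohomologyMap :
    (cohomologySignature S G k a).comp (projCohomologyMap G k hq hS) =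
      (regionCohomologyMap a G k hq hS).comp (cohomologySignature S G k (Φ a)) := by
  refine AddCommGroup.DirectLimit.hom_ext _ fun r => AddMonoidHom.ext fun x => ?_
  simp only [AddMonoidHom.comp_apply, projCohomologyMap, cohomologySignature, regionCohomologyMap,
    AddCommGroup.DirectLimit.lift_of, AddCommGroup.DirectLimit.map_apply_of]
  congr 1
  exact CubicalComplex.Hom.cohomologyMap_square _ _ _ _ (caMap_sectionHom a hq hS r) _ _

theorem HasCohomologyDefect.image (hsurj : Function.Surjective (projCohomologyMap G k hq hS))
    (h : HasCohomologyDefect S G k a) : HasCohomologyDefect S G k (Φ a) := by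
  refine ⟨image_mem_slightlyDefective hq hS h.1, fun h0 => h.2 ?_⟩
  rw [← AddMonoidHom.cancel_right hsurj, cohomologySignature_comp_projCohomologyMap, h0,
    AddMonoidHom.comp_zero, AddMonoidHom.zero_comp]

end Persistence

/-! ### The topology of the tile complexes -/

section Rays

variable {X Y : Type*} [TopologicalSpace X] [TopologicalSpace Y] {k : ℕ}

theorem FreelyHomotopic.of_eq {x y : X} (hxy : x = y) {f : GenLoop (Fin k) X x}
    {g : GenLoop (Fin k) X y} (h : ∀ p, f p = g p) : FreelyHomotopic f g := by
  subst hxy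
  rw [GenLoop.ext f g h]
  exact .refl g

theorem mapLoop_const (f : C(X, Y)) {x : X} {y : Y} (h : f x = y) :
    mapLoop f h (GenLoop.const : GenLoop (Fin k) X x) = GenLoop.const :=
  GenLoop.ext _ _ fun _ => h

theorem RayRel.freelyHomotopic {ρ : Ray Y} {x y : Σ t : ρ.dom, GenLoop (Fin k) Y (ρ.pt t)}
    (h : RayRel k ρ x y) : FreelyHomotopic x.2 y.2 := by
  obtain ⟨H, hH0, hH1, hHb⟩ := h
  let segment : I → ℝ≥0 := fun s =>
    unitInterval.toNNReal (σ s) * x.1.1 + unitInterval.toNNReal s * y.1.1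
  have segment_mem (s : I) : segment s ∈ ρ.dom :=
    ρ.upper.ordConnected.convex (𝕜 := ℝ≥0) x.1.2 y.1.2 zero_le zero_le
      (unitInterval.toNNReal_symm_add_toNNReal s)
  have continuous_segment : Continuous segment := by fun_prop
  let track : Path (ρ.pt x.1) (ρ.pt y.1) :=
    ⟨⟨fun s => ρ.pt ⟨segment s, segment_mem s⟩,
      ρ.continuous_pt.comp (continuous_segment.subtype_mk segment_mem)⟩,
      congrArg ρ.pt (Subtype.ext (by simp [segment])),
      congrArg ρ.pt (Subtype.ext (by simp [segment]))⟩
  exact ⟨track, ⟨H, hH0, hH1⟩, fun s p hp => hHb s p hp ⟨segment s, segment_mem s⟩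
    (by simp [segment])⟩

namespace RayPi

variable {ρ : Ray Y}

theorem freelyHomotopic {x y : Σ t : ρ.dom, GenLoop (Fin k) Y (ρ.pt t)}
    (h : (Quot.mk _ x : RayPi k Y ρ) = Quot.mk _ y) : FreelyHomotopic x.2 y.2 := by
  have hxy := Quot.eqvGen_exact h
  clear h
  induction hxy with
  | rel _ _ h => exact RayRel.freelyHomotopic h
  | refl x => exact .refl x.2
  | symm _ _ _ ih => exact ih.symm
  | trans _ _ _ _ _ ih ih' => exact ih.trans ih'

theorem isOne_mk {t : ρ.dom} {g : GenLoop (Fin k) Y (ρ.pt t)} :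
    IsOne (Quot.mk _ ⟨t, g⟩ : RayPi k Y ρ) ↔ GenLoop.Homotopic g GenLoop.const := by
  constructor
  · rintro ⟨t', h⟩
    exact (freelyHomotopic h).homotopic_const
  · rintro ⟨H⟩
    refine ⟨t, Quot.sound ⟨H.toContinuousMap, H.apply_zero, H.apply_one, fun s p hp t' ht' => ?_⟩⟩
    have ht : t' = t := Subtype.ext (NNReal.coe_injective (ht'.trans (by simp; ring)))
    rw [ht]
    exact (H.prop s p hp).trans (g.2 p hp)

end RayPi

end Rays

section Sections

variable {D : ℕ} {A : Type*} {S : Set (Config D A)}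

theorem mem_unitCube_floor (p : Fin D → ℝ) : p ∈ unitCube fun i => ⌊p i⌋ :=
  fun _ => ⟨Int.floor_le _, (Int.lt_floor_add_one _).le⟩

theorem mk_tile_congr {r : ℕ} {z : Lattice D} {b b' : Adm S r} (h : b.1 = b'.1)
    (p : unitCube z) : (Quot.mk _ ⟨(z, b), p⟩ : TileSpace S r) = Quot.mk _ ⟨(z, b'), p⟩ := by
  rw [Subtype.ext h]

variable (hinv : ∀ v, MapsTo (shift v) S S)
include hinv

theorem mem_thicken_of_mem {a : Config D A} (ha : a ∈ S) (r : ℕ) (p : Fin D → ℝ) :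
    p ∈ thicken (unflawed S a r) :=
  ⟨_, fun _ _ => mem_unflawed_of_mem hinv ha r _, mem_unitCube_floor p⟩

/-- The section of the projection of `X_r` to `ℝ^D` determined by an element of the subshift. -/
noncomputable def fullSection (c : S) (r : ℕ) : C(Fin D → ℝ, TileSpace S r) :=
  (sectionMap S c.1 r).comp ⟨fun p => ⟨p, mem_thicken_of_mem hinv c.2 r p⟩, by fun_prop⟩

variable {r : ℕ} {z : Lattice D} {p : Fin D → ℝ}

theorem fullSection_apply (c : S) (hp : p ∈ unitCube z) :
    fullSection hinv c r p =
      Quot.mk _ ⟨(z, ⟨blockAt c.1 r z, mem_unflawed_of_mem hinv c.2 r z⟩), ⟨p, hp⟩⟩ :=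
  sectionMap_apply c.1 r _ (fun _ _ => mem_unflawed_of_mem hinv c.2 r _) hp

theorem exists_fullSection_eq (y : TileSpace S r) :
    ∃ (c : S) (p : Fin D → ℝ), fullSection hinv c r p = y := by
  obtain ⟨⟨⟨z, ⟨_, d, hd, rfl⟩⟩, ⟨p, hp⟩⟩, rfl⟩ := Quot.exists_rep y
  refine ⟨⟨shift (-z) d, hinv _ hd⟩, p, (fullSection_apply hinv _ hp).trans ?_⟩
  exact mk_tile_congr ((blockAt_shift r _ z).trans (by rw [add_neg_cancel])) ⟨p, hp⟩

theorem joined_fullSection_of_blockAt_eq {c d : S} (h : blockAt c.1 r z = blockAt d.1 r z)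
    (p p' : Fin D → ℝ) : Joined (fullSection hinv c r p) (fullSection hinv d r p') := by
  let corner : Fin D → ℝ := fun i => z i
  have corner_mem : corner ∈ unitCube z := fun i => ⟨le_rfl, (lt_add_one _).le⟩
  have heq : fullSection hinv c r corner = fullSection hinv d r corner := by
    rw [fullSection_apply hinv c corner_mem, fullSection_apply hinv d corner_mem]
    exact mk_tile_congr h _
  have hc := (PathConnectedSpace.joined p corner).map (fullSection hinv c r).continuous
  have hd := (PathConnectedSpace.joined corner p').map (fullSection hinv d r).continuous
  exact hc.trans (heq ▸ hd)

/-- The projection of `X_r` to `ℝ^D`. -/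
def tileProj (S : Set (Config D A)) (r : ℕ) : C(TileSpace S r, Fin D → ℝ) where
  toFun := Quot.lift (fun x => x.2.1) fun _ _ h => h.2
  continuous_toFun := continuous_quot_lift _ (continuous_sigma fun _ => continuous_subtype_val)

theorem tileProj_fullSection (c : S) (p : Fin D → ℝ) :
    tileProj S r (fullSection hinv c r p) = p := by
  rw [fullSection_apply hinv c (mem_unitCube_floor p)]
  rfl

theorem homotopic_const_of_subsingleton (hsub : S.Subsingleton) {k : ℕ} {y : TileSpace S r}
    (f : GenLoop (Fin k) (TileSpace S r) y) : GenLoop.Homotopic f GenLoop.const := by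
  obtain ⟨c, -⟩ := exists_fullSection_eq hinv y
  refine homotopic_const_of_retract (tileProj S r) (fullSection hinv c r) (fun x => ?_) f
  obtain ⟨d, p, rfl⟩ := exists_fullSection_eq hinv x
  rw [tileProj_fullSection, Subtype.ext (hsub c.2 d.2)]

end Sections

section WeaklyMixing

variable {D : ℕ} {A : Type*} [TopologicalSpace A] [DiscreteTopology A] {S : Set (Config D A)}

theorem finite_box (D r : ℕ) : (box D r).Finite :=
  (Set.finite_Icc (fun _ => -(r : ℤ)) fun _ => (r : ℤ)).subset fun _ hx =>
    ⟨fun i => (abs_le.1 (hx i)).1, fun i => (abs_le.1 (hx i)).2⟩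

theorem isOpen_setOf_blockAt_eq (r : ℕ) (z : Lattice D) (b : Block D A r) :
    IsOpen {a : Config D A | blockAt a r z = b} := by
  have := (finite_box D r).to_subtype
  have hcont : Continuous fun a : Config D A => blockAt a r z :=
    continuous_pi fun _ => continuous_apply _
  exact (isOpen_discrete {b}).preimage hcont

theorem IsWeaklyMixing.exists_blockAt_eq (hw : IsWeaklyMixing S) (r : ℕ) (c d : S) :
    ∃ (e e' : S) (z : Lattice D), blockAt e.1 r 0 = blockAt c.1 r 0 ∧
      blockAt e'.1 r 0 = blockAt d.1 r 0 ∧ blockAt e.1 r z = blockAt e'.1 r z := by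
  let cylinder (b b' : Block D A r) : Set (Config D A × Config D A) :=
    {a | blockAt a r 0 = b} ×ˢ {a | blockAt a r 0 = b'}
  have isOpen_cylinder (b b') : IsOpen (cylinder b b') :=
    (isOpen_setOf_blockAt_eq r 0 b).prod (isOpen_setOf_blockAt_eq r 0 b')
  obtain ⟨z, -, ⟨⟨e, e'⟩, ⟨⟨he, he'⟩, heS, heS'⟩, rfl⟩, ⟨hze, hze'⟩, -⟩ :=
    hw (cylinder (blockAt c.1 r 0) (blockAt d.1 r 0)) (cylinder (blockAt c.1 r 0) (blockAt c.1 r 0))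
      (isOpen_cylinder _ _) (isOpen_cylinder _ _)
      ⟨(c.1, d.1), ⟨rfl, rfl⟩, c.2, d.2⟩ ⟨(c.1, c.1), ⟨rfl, rfl⟩, c.2, c.2⟩
  have hz : blockAt (shift z e) r 0 = blockAt (shift z e') r 0 := hze.trans hze'.symm
  rw [blockAt_shift, blockAt_shift, zero_add] at hz
  exact ⟨⟨e, heS⟩, ⟨e', heS'⟩, z, he, he', hz⟩

theorem IsWeaklyMixing.joined (hinv : ∀ v, MapsTo (shift v) S S) (hw : IsWeaklyMixing S) {r : ℕ}
    (y y' : TileSpace S r) : Joined y y' := by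
  obtain ⟨c, p, rfl⟩ := exists_fullSection_eq hinv y
  obtain ⟨d, p', rfl⟩ := exists_fullSection_eq hinv y'
  obtain ⟨e, e', z, he, he', hz⟩ := hw.exists_blockAt_eq r c d
  exact ((joined_fullSection_of_blockAt_eq hinv he.symm p 0).trans
    (joined_fullSection_of_blockAt_eq hinv hz 0 0)).trans
    (joined_fullSection_of_blockAt_eq hinv he' 0 p')

end WeaklyMixing

section VertexInjective

variable {D : ℕ} {A : Type*} {S : Set (Config D A)} {r : ℕ} (hr : 1 ≤ r)

include hr in
theorem Face.InCube.sub_mem_box {F : Face D} {z : Lattice D} (h : F.InCube z) :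
    F.base - z ∈ box D r := by
  intro i
  rw [Pi.sub_apply]
  rcases h i with h | ⟨-, h⟩ <;> rw [h]
  · simp
  · simpa using hr

/-- The symbol at the base point of a cell of `X_r`. For `r ≥ 1` this position lies in the block of
every cube containing the cell, and glued cubes agree there. -/
def cellLabel (S : Set (Config D A)) : (tileComplex S r).Cell → A :=
  Quot.lift (fun x => x.1.1.2.1 ⟨x.1.2.base - x.1.1.1, x.2.sub_mem_box hr⟩) (by
    rintro ⟨⟨⟨z, b⟩, F⟩, hF⟩ ⟨⟨⟨_, b'⟩, _⟩, hF'⟩ ⟨⟨d, rfl, hmatch⟩, rfl⟩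
    have hbase : F.base - (z + unitVec d) + unitVec d = F.base - z := by abel
    exact (congrArg b.1 (Subtype.ext hbase.symm)).trans
      (hmatch _ (hF'.sub_mem_box hr) (hbase ▸ hF.sub_mem_box hr)))

include hr in
theorem VertexInjective.subsingleton (hinv : ∀ v, MapsTo (shift v) S S)
    (h : VertexInjective S r) : S.Subsingleton := by
  let vertex (c : Config D A) (hc : c ∈ S) : (tileComplex S r).Cell :=
    Quot.mk _ ⟨((0, ⟨blockAt c r 0, c, hc, rfl⟩), ⟨0, ∅⟩), fun _ => Or.inl rfl⟩
  have eq_zero (c) (hc : c ∈ S) (c') (hc' : c' ∈ S) : c 0 = c' 0 := by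
    have hlabel := congrArg (cellLabel hr S) (h (vertex c hc) (vertex c' hc') rfl rfl rfl)
    change blockAt c r 0 _ = blockAt c' r 0 _ at hlabel
    simpa [blockAt] using hlabel
  intro c hc c' hc'
  funext z
  simpa [shift] using eq_zero _ (hinv z hc) _ (hinv z hc')

end VertexInjective

/-! ### Homotopy defects -/

section BasePoints

variable {D : ℕ} {A : Type*} {S : Set (Config D A)} {k r s t : ℕ}

theorem restrict_restrict (h : r ≤ s) (h' : s ≤ t) (x : TileSpace S t) :
    (restrictMap S h).spaceMap ((restrictMap S h').spaceMap x) =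
      (restrictMap S (h.trans h')).spaceMap x := by
  induction x using Quot.ind
  rfl

/-- The image in `X_r` of a loop at `x_s(c)`, for `r ≤ s`. -/
def restrictLoop (c : S) (h : r ≤ s) (f : GenLoop (Fin k) (TileSpace S s) (basePt c s)) :
    GenLoop (Fin k) (TileSpace S r) (basePt c r) :=
  mapLoop (restrictMap S h).spaceMap (restrict_basePt c h) f

theorem restrictLoop_restrictLoop (c : S) (h : r ≤ s) (h' : s ≤ t)
    (f : GenLoop (Fin k) (TileSpace S t) (basePt c t)) :
    restrictLoop c h (restrictLoop c h' f) = restrictLoop c (h.trans h') f :=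
  GenLoop.ext _ _ fun p => restrict_restrict h h' (f p)

theorem homotopic_restrictLoop {c : S} (h : r ≤ s)
    {f g : GenLoop (Fin k) (TileSpace S s) (basePt c s)} (hfg : GenLoop.Homotopic f g) :
    GenLoop.Homotopic (restrictLoop c h f) (restrictLoop c h g) :=
  hfg.comp_continuousMap _

/-- Freely homotopic `k`-dimensional loops at `x_s(c)` have homotopic images in `X_r`: the action
of `π_1` on `π_k` becomes trivial there. -/
def CollapsesFree (k : ℕ) (c : S) (h : r ≤ s) : Prop :=
  ∀ f g : GenLoop (Fin k) (TileSpace S s) (basePt c s), FreelyHomotopic f g →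
    GenLoop.Homotopic (restrictLoop c h f) (restrictLoop c h g)

theorem piOneMap_mk (c : S) (h : r ≤ s) (γ : Path (basePt c s) (basePt c s)) :
    piOneMap c h (FundamentalGroup.fromPath (.mk γ)) =
      FundamentalGroup.fromPath (.mk ((γ.map (restrictMap S h).spaceMap.continuous).cast
        (restrict_basePt c h).symm (restrict_basePt c h).symm)) := by
  rw [piOneMap, FundamentalGroup.mapOfEq_apply]
  rfl

namespace CollapsesFree

variable {c : S} {h : r ≤ s}

theorem of_trivial (htriv : ∀ u, piOneMap c h u = 1) : CollapsesFree k c h := by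
  rintro f g ⟨γ, hγ⟩
  have hγ_triv := htriv (FundamentalGroup.fromPath (.mk γ))
  rw [piOneMap_mk] at hγ_triv
  exact (hγ.map (restrictMap S h).spaceMap (restrict_basePt c h) (restrict_basePt c h)).homotopic
    (Path.Homotopic.Quotient.exact hγ_triv)

theorem of_comm
    (hcomm : ∀ u v, piOneMap c h u * piOneMap c h v = piOneMap c h v * piOneMap c h u) :
    CollapsesFree 1 c h := by
  rintro f g ⟨γ, hγ⟩
  let cls (γ : Path (basePt c s) (basePt c s)) : FundamentalGroup (TileSpace S s) (basePt c s) :=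
    .fromPath (.mk γ)
  have hconj : cls γ * cls (loopPath f) = cls (loopPath g) * cls γ :=
    Path.Homotopic.Quotient.eq.2 hγ.loopPath_trans
  have heq : piOneMap c h (cls (loopPath f)) = piOneMap c h (cls (loopPath g)) := by
    have hmap := congrArg (piOneMap c h) hconj
    rw [map_mul, map_mul, hcomm (cls (loopPath g))] at hmap
    exact mul_left_cancel hmap
  rw [piOneMap_mk, piOneMap_mk] at heq
  exact homotopic_of_loopPath (Path.Homotopic.Quotient.exact heq)

theorem of_joined {d : S} (hd : CollapsesFree k d h) (hcd : Joined (basePt c s) (basePt d s)) :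
    CollapsesFree k c h := by
  intro f g hfg
  obtain ⟨β⟩ := hcd
  obtain ⟨f', hf⟩ := TrackHomotopic.exists_right β f
  obtain ⟨g', hg⟩ := TrackHomotopic.exists_right β g
  have hfg' : FreelyHomotopic f' g' :=
    (FreelyHomotopic.trans ⟨_, hf.symm⟩ hfg).trans ⟨_, hg⟩
  have hf' := hf.map (restrictMap S h).spaceMap (restrict_basePt c h) (restrict_basePt d h)
  have hg' := hg.map (restrictMap S h).spaceMap (restrict_basePt c h) (restrict_basePt d h)
  refine ((hf'.trans (.of_homotopic (hd f' g' hfg'))).trans hg'.symm).homotopic ?_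
  exact (Path.Homotopic.hcomp ⟨Path.Homotopy.transRefl _⟩ (.refl _)).trans
    ⟨(Path.Homotopy.reflTransSymm _).symm⟩

end CollapsesFree

/-- The tower of the `k`-th homotopy groups of the spaces `X_r` does not depend on base points: the
spaces are path connected, and `π_1` acts trivially on the tower. -/
structure BasepointIndependent (S : Set (Config D A)) (k : ℕ) : Prop where
  joined : ∀ r (y y' : TileSpace S r), Joined y y'
  collapses : ∀ (c : S) r, ∃ s, ∃ h : r ≤ s, CollapsesFree k c h

theorem BasepointIndependent.of_collapses {d : S} (hj : ∀ r (y y' : TileSpace S r), Joined y y')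
    (hd : ∀ r, ∃ s, ∃ h : r ≤ s, CollapsesFree k d h) : BasepointIndependent S k where
  joined := hj
  collapses _ r := (hd r).imp fun _ => Exists.imp fun _ hd => hd.of_joined (hj _ _ _)

theorem IsBasepointFree.subsingleton_or_basepointIndependent [TopologicalSpace A]
    [DiscreteTopology A] (hinv : ∀ v, MapsTo (shift v) S S) (hb : IsBasepointFree S k) :
    S.Subsingleton ∨ BasepointIndependent S k := by
  rcases hb with ⟨r, hr⟩ | ⟨hw, rfl, d, hd⟩ | ⟨hw, d, hd⟩
  · exact .inl ((hr _ (le_max_left r 1)).subsingleton (le_max_right r 1) hinv)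
  · exact .inr <| .of_collapses (fun _ => hw.joined hinv) fun r =>
      (hd r).imp fun _ => Exists.imp fun _ => CollapsesFree.of_comm
  · exact .inr <| .of_collapses (fun _ => hw.joined hinv) fun r =>
      (hd r).imp fun _ => Exists.imp fun _ => CollapsesFree.of_trivial

namespace BasepointIndependent

variable (hb : BasepointIndependent S k) {y : ∀ r, TileSpace S r}
  (g : ∀ r, GenLoop (Fin k) (TileSpace S r) (y r))
  (hg : ∀ r s (h : r ≤ s), FreelyHomotopic (mapLoop (restrictMap S h).spaceMap rfl (g s)) (g r))

include hb hg

/-- Moving each `g r` to the base point gives loops `f r` compatible up to free homotopy only; the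
images in `X_r` of the `f s` for `s` large are compatible up to homotopy. -/
theorem exists_projPi (c : S) :
    ∃ W : ProjPi k c, ∀ r, ∃ w, W.1 r = ⟦w⟧ ∧ FreelyHomotopic w (g r) := by
  have exists_based (r) : ∃ f : GenLoop (Fin k) (TileSpace S r) (basePt c r),
      FreelyHomotopic f (g r) := by
    obtain ⟨γ⟩ := hb.joined r (y r) (basePt c r)
    obtain ⟨f, hf⟩ := TrackHomotopic.exists_right γ (g r)
    exact ⟨f, _, hf.symm⟩
  choose f hf using exists_based
  choose m hm hcol using hb.collapses c
  have restrict_f {r s} (h : r ≤ s) : FreelyHomotopic (restrictLoop c h (f s)) (f r) :=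
    (((hf s).map (restrictMap S h).spaceMap (restrict_basePt c h) rfl).trans (hg r s h)).trans
      (hf r).symm
  let w (r) : GenLoop (Fin k) (TileSpace S r) (basePt c r) := restrictLoop c (hm r) (f (m r))
  have w_homotopic {r s} (h : m r ≤ s) :
      GenLoop.Homotopic (w r) (restrictLoop c ((hm r).trans h) (f s)) := by
    rw [← restrictLoop_restrictLoop c (hm r) h]
    exact hcol r _ _ (restrict_f h).symm
  have w_compatible {r s} (h : r ≤ s) : GenLoop.Homotopic (restrictLoop c h (w s)) (w r) := by
    have hs := le_max_right (m r) (m s)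
    have hws := homotopic_restrictLoop h (w_homotopic hs)
    rw [restrictLoop_restrictLoop c h ((hm s).trans hs)] at hws
    exact hws.trans (w_homotopic (le_max_left (m r) (m s))).symm
  exact ⟨⟨fun r => ⟦w r⟧, fun r s h => Quotient.sound (w_compatible h)⟩,
    fun r => ⟨w r, rfl, (restrict_f (hm r)).trans (hf r)⟩⟩

variable {Φ : Config D A → Config D A} {q : ℕ} (hq : HasRadius Φ q) (hS : MapsTo Φ S S)

theorem homotopic_const_of_injective {c : S} (hinj : Function.Injective (projPiMap hq hS k c))
    (hΦ : ∀ r, GenLoop.Homotopic (mapLoop (caMap hq hS r).spaceMap rfl (g (r + q)))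
      GenLoop.const) (r : ℕ) : GenLoop.Homotopic (g r) GenLoop.const := by
  obtain ⟨W, hW⟩ := hb.exists_projPi g hg c
  let one : ProjPi k c :=
    ⟨fun r => ⟦GenLoop.const⟧, fun r s h => congrArg (Quotient.mk _) (mapLoop_const _ _)⟩
  have hW_one : projPiMap hq hS k c W = projPiMap hq hS k c one := by
    refine Subtype.ext (funext fun r => ?_)
    obtain ⟨w, hw, hwg⟩ := hW (r + q)
    change piMap _ _ (W.1 (r + q)) = piMap _ _ ⟦GenLoop.const⟧
    rw [hw]
    refine Quotient.sound ?_
    rw [mapLoop_const]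
    exact ((hwg.map (caMap hq hS r).spaceMap (caMap_basePt hq hS c r) rfl).trans
      (.of_homotopic (hΦ r))).homotopic_const
  obtain ⟨w, hw, hwg⟩ := hW r
  have hw_one : GenLoop.Homotopic w GenLoop.const :=
    Quotient.exact (hw.symm.trans (by rw [hinj hW_one]))
  exact (hwg.symm.trans (.of_homotopic hw_one)).homotopic_const

end BasepointIndependent

end BasePoints

section HomotopyDefects

variable {D : ℕ} {A : Type*} {S : Set (Config D A)} {k : ℕ} {a : Config D A}

theorem homotopySignature_isOne_iff {ω : ProperBaseRay S a} {u : RegionPi k ω} {r : ℕ}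
    {l : Σ t : (ω.rayAt r).dom, GenLoop (Fin k) _ ((ω.rayAt r).pt t)} (hl : Quot.mk _ l = u.1 r) :
    ((homotopySignature k ω u).1 r).IsOne ↔
      GenLoop.Homotopic (mapLoop (sectionMap S a r) rfl l.2) GenLoop.const := by
  change (RayPi.map _ (ω.rayAt_dom_subset r) (fun _ => rfl) (u.1 r)).IsOne ↔ _
  rw [← hl]
  exact RayPi.isOne_mk

theorem HasHomotopyDefect.isDefective (hinv : ∀ v, MapsTo (shift v) S S)
    (h : HasHomotopyDefect S k a) : IsDefective S a := by
  refine ⟨h.1, fun ha => ?_⟩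
  obtain ⟨-, ω, u, r, hr⟩ := h
  obtain ⟨l, hl⟩ := Quot.exists_rep (u.1 r)
  have hl_const : GenLoop.Homotopic l.2 GenLoop.const :=
    homotopic_const_of_retract ⟨Subtype.val, continuous_subtype_val⟩
      ⟨fun p => ⟨p, mem_thicken_of_mem hinv ha r p⟩, by fun_prop⟩ (fun _ => rfl) l.2
  refine hr ((homotopySignature_isOne_iff hl).2 ?_)
  rw [← mapLoop_const (sectionMap S a r) rfl]
  exact hl_const.comp_continuousMap _

section Image

variable {Φ : Config D A → Config D A} {q : ℕ} (hq : HasRadius Φ q) (hS : MapsTo Φ S S)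

/-- A proper base ray for `a` is a proper base ray for `Φ a`. -/
def ProperBaseRay.image (ω : ProperBaseRay S a) : ProperBaseRay S (Φ a) where
  toFun := ω.toFun
  continuous_toFun := ω.continuous_toFun
  tendsto_norm := ω.tendsto_norm
  eventually_mem r := (ω.eventually_mem (r + q)).mono fun _ ht =>
    thicken_mono (unflawed_subset_image a hq hS r) ht

variable (a) in
/-- The inclusion of `G_{r+q}(a)` into `G_r(Φ(a))`. -/
def regionImageMap (r : ℕ) : C(thicken (unflawed S a (r + q)), thicken (unflawed S (Φ a) r)) :=
  ⟨fun p => ⟨p.1, thicken_mono (unflawed_subset_image a hq hS r) p.2⟩, by fun_prop⟩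

theorem ProperBaseRay.rayAt_dom_image (ω : ProperBaseRay S a) (r : ℕ) :
    (ω.rayAt (r + q)).dom ⊆ ((ω.image hq hS).rayAt r).dom :=
  fun _ ht t' ht' => thicken_mono (unflawed_subset_image a hq hS r) (ht t' ht')

/-- The map `π_k(G_∞(a), ω) → π_k(G_∞(Φ(a)), ω)` induced by the inclusions of `G_{r+q}(a)` into
`G_r(Φ(a))`. -/
noncomputable def regionPiMap {ω : ProperBaseRay S a} (u : RegionPi k ω) :
    RegionPi k (ω.image hq hS) :=
  ⟨fun r => RayPi.map (regionImageMap a hq hS r) (ω.rayAt_dom_image hq hS r) (fun _ => rfl)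
    (u.1 (r + q)), fun r s h =>
    (RayPi.map_square (regionImageMap a hq hS s) (regionMap S (Φ a) h)
      (regionMap S a (Nat.add_le_add_right h q)) (regionImageMap a hq hS r)
      _ (fun _ => rfl) _ (fun _ => rfl) (ω.rayAt_dom (Nat.add_le_add_right h q)) (fun _ => rfl)
      _ (fun _ => rfl) (fun _ => rfl) _).trans
    (congrArg _ (u.2 _ _ (Nat.add_le_add_right h q)))⟩

theorem homotopic_const_of_isOne_regionPiMap {ω : ProperBaseRay S a} {u : RegionPi k ω} {r : ℕ}
    {l : Σ t : (ω.rayAt (r + q)).dom, GenLoop (Fin k) _ ((ω.rayAt (r + q)).pt t)}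
    (hl : Quot.mk _ l = u.1 (r + q))
    (h : ((homotopySignature k (ω.image hq hS) (regionPiMap hq hS u)).1 r).IsOne) :
    GenLoop.Homotopic
      (mapLoop (caMap hq hS r).spaceMap rfl (mapLoop (sectionMap S a (r + q)) rfl l.2))
      GenLoop.const := by
  have himage := (homotopySignature_isOne_iff (u := regionPiMap hq hS u)
    (congrArg (RayPi.map (regionImageMap a hq hS r) (ω.rayAt_dom_image hq hS r)
      fun _ => rfl) hl)).1 h
  exact ((FreelyHomotopic.of_eq (caMap_sectionMap a hq hS r _)
    fun p => caMap_sectionMap a hq hS r (l.2 p)).trans (.of_homotopic himage)).homotopic_const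

theorem HasHomotopyDefect.image [TopologicalSpace A] [DiscreteTopology A]
    (hinv : ∀ v, MapsTo (shift v) S S) (hb : IsBasepointFree S k) {c : S}
    (hinj : Function.Injective (projPiMap hq hS k c)) (h : HasHomotopyDefect S k a) :
    HasHomotopyDefect S k (Φ a) := by
  obtain ⟨ha, ω, u, r₀, hr₀⟩ := h
  refine ⟨image_mem_slightlyDefective hq hS ha, ?_⟩
  by_contra! himage
  choose l hl using fun r => Quot.exists_rep (u.1 r)
  refine hr₀ ((homotopySignature_isOne_iff (hl r₀)).2 ?_)
  rcases hb.subsingleton_or_basepointIndependent hinv with hsub | hind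
  · exact homotopic_const_of_subsingleton hinv hsub _
  refine hind.homotopic_const_of_injective (fun r => mapLoop (sectionMap S a r) rfl (l r).2)
    (fun r s h => ?_) hq hS hinj
    (fun r => homotopic_const_of_isOne_regionPiMap hq hS (hl _) (himage _ (regionPiMap hq hS u) r))
    r₀
  have hcompat := u.2 r s h
  rw [← hl r, ← hl s] at hcompat
  exact (FreelyHomotopic.of_eq (restrict_sectionMap a h _)
    fun p => restrict_sectionMap a h ((l s).2 p)).trans
    ((RayPi.freelyHomotopic hcompat).map (sectionMap S a r) rfl rfl)

end Image

end HomotopyDefects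

end CADefect

theorem corollary3p4_general {D : ℕ} {A : Type*} [TopologicalSpace A] [DiscreteTopology A]
    {S : Set (Config D A)} (hinv : ∀ v, Set.MapsTo (shift v) S S) {Φ : Config D A → Config D A}
    {q : ℕ} (hq : HasRadius Φ q) (hS : Set.MapsTo Φ S S) {k : ℕ} (hk : 1 ≤ k) :
    (IsBasepointFree S k → ∀ c : S, Function.Injective (projPiMap hq hS k c) →
      ∀ a : Config D A, HasHomotopyDefect S k a → IsPersistent S Φ a) ∧
    (∀ (G : Type*) [AddCommGroup G],
      (Function.Injective (projHomologyMap G k hq hS) →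
        ∀ a : Config D A, HasHomologyDefect S G k a → IsPersistent S Φ a) ∧
      (Function.Surjective (projCohomologyMap G k hq hS) →
        ∀ a : Config D A, HasCohomologyDefect S G k a → IsPersistent S Φ a)) :=
  ⟨fun hb _ hinj _ => isPersistent_of_invariant (fun _ => HasHomotopyDefect.isDefective hinv)
      fun _ => HasHomotopyDefect.image hq hS hinv hb hinj,
    fun _ _ =>
      ⟨fun hinj _ => isPersistent_of_invariant (fun _ => HasHomologyDefect.isDefective hinv hk)
          fun _ => HasHomologyDefect.image hq hS hinj,
        fun hsurj _ => isPersistent_of_invariant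
          (fun _ => HasCohomologyDefect.isDefective hinv hk)
          fun _ => HasCohomologyDefect.image hq hS hsurj⟩⟩

theorem corollary3p4 {D : ℕ} (hD : 1 ≤ D) {A : Type*} [Finite A] [TopologicalSpace A]
    [DiscreteTopology A] (S : Set (Config D A)) (hSFT : IsSFT S)
    (Φ : Config D A → Config D A) (hΦ : IsCA Φ) (hS : Set.MapsTo Φ S S) (k : ℕ) (hk : 1 ≤ k) :
    (IsBasepointFree S k → ∀ c : S, Function.Injective (projPiMap hΦ.hasRadius hS k c) →
      ∀ a : Config D A, HasHomotopyDefect S k a → IsPersistent S Φ a) ∧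
    (∀ (G : Type*) [AddCommGroup G],
      (Function.Injective (projHomologyMap G k hΦ.hasRadius hS) →
        ∀ a : Config D A, HasHomologyDefect S G k a → IsPersistent S Φ a) ∧
      (Function.Surjective (projCohomologyMap G k hΦ.hasRadius hS) →
        ∀ a : Config D A, HasCohomologyDefect S G k a → IsPersistent S Φ a)) :=
  corollary3p4_general (fun v => Set.mapsTo_iff_image_subset.2 (hSFT.1.2 v).subset)
    hΦ.hasRadius hS hk
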